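/- **Setting.** Let $0\le k\le n$ range over time indices with horizon $n$; let $(E_k)_{0\le k\le n}$ be measurable spaces, $\eta_0$ a probability measure on $E_0$, and $M_{k+1}(x,dy)$ $(0\le k<n)$ Markov kernels from $E_k$ to $E_{k+1}$ of the form $M_{k+1}(x,dy)=H_{k+1}(x,y)\,\lambda_{k+1}(dy)$, with $\lambda_{k+1}$ a measure on $E_{k+1}$ and $H_{k+1}:E_k\times E_{k+1}\to(0,\infty)$ jointly measurable. Let $f_k:E_k\to\mathbb R$ $(k\le n)$ and $G_k:E_k\to(0,\infty)$ $(k<n)$ be measurable. Put $$v_n=f_n,\qquad v_k(x)=f_k(x)\vee\Big[G_k(x)\int M_{k+1}(x,dy)\,v_{k+1}(y)\Big]\quad(0\le k<n),$$ and assume that these integrals converge absolutely for every $x$. Let $Q_{k+1}(\varphi)(x)=G_k(x)\int M_{k+1}(x,dy)\varphi(y)$, $Q_{k,l}=Q_{k+1}Q_{k+2}\cdots Q_l$ and $Q_{k,k}=\mathrm{Id}$. **Particle model.** Let $N\ge1$ and let $s\in\mathbb R$ be such that $sG_k$ takes values in $[0,1]$ for all $k<n$. Let $\xi_k=(\xi_k^i)_{1\le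 i\le N}\in E_k^N$, $0\le k\le n$, be random variables on a probability space such that the $\xi^i_0$ are i.i.d. with law $\eta_0$ and, for $k<n$, given $\sigma(\xi_0,\dots,\xi_k)$, the $\xi_{k+1}^i$ are independent, $\xi_{k+1}^i$ being obtained as follows: with probability $sG_k(\xi_k^i)$ keep $\widehat\xi_k^i=\xi_k^i$, otherwise let $\widehat\xi^i_k=\xi_k^j$ with probability $G_k(\xi_k^j)/\sum_{m}G_k(\xi_k^m)$; then draw $\xi_{k+1}^i$ from $M_{k+1}(\widehat\xi_k^i,\cdot)$. With $\eta_k^N=\frac1N\sum_i\delta_{\xi_k^i}$, define $\widehat v_n=f_n$ and, for $0\le k<n$, $x\in E_k$, $$\widehat v_k(x)=f_k(x)\vee\int \eta^N_{k+1}(dy)\,\frac{G_k(x)H_{k+1}(x,y)\,\eta_k^N(G_k)}{\eta_k^N\big(G_kH_{k+1}(\cdot,y)\big)}\,\widehat v_{k+1}(y).$$ **Constants.** Let $\|\cdot\|$ be the supremum norm, $h_{k+1}(y)=\sup_{x,x'\in E_k}H_{k+1}(x,y)/H_{k+1}(x',y)$, and for an integer $p\ge1$ let $p'$ be the smallest even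 integer greater than $p$. For $k\le l<n$ put $$q^{(p)}_{k,l}=\Big[\|G_l\|\,\|h_{k+1}\|\prod_{m=k}^{l-1}\|G_m\|\Big]^{\frac{p'-1}{p'}},\qquad c_k(x)=\sup_{p\ge1}\ \sum_{k\le l<n}2\,q^{(p)}_{k,l}\Big[Q_{k,l+1}\big(h_{l+1}^{p'-1}v_{l+1}^{p'}\big)(x)\Big]^{\frac1{p'}}\in[0,\infty].$$ **Proposition (exponential concentration).** For all $0\le k\le n$ and $\varepsilon>0$: 1. for every $x\in E_k$ and every real $c>0$ with $c\ge c_k(x)$, $$\mathbb P\Big(|v_k(x)-\widehat v_k(x)|>\frac{c}{\sqrt N}+\varepsilon\Big)\le\exp\big(-N\varepsilon^2/c^2\big);$$ 2. consequently, for every real $c>0$ with $c\ge\sup_{x\in E_k}c_k(x)$, $$\sup_{x\in E_k}\mathbb P\Big(|v_k(x)-\widehat v_k(x)|>\frac{c}{\sqrt N}+\varepsilon\Big)\le\exp\big(-N\varepsilon^2/c^2\big).$$ -/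

import Mathlib

open MeasureTheory ProbabilityTheory Set
open scoped ENNReal

noncomputable section

namespace PathSnell

universe u

/-!
Time-indexed objects attached to a transition carry the index of its *starting* time:
`M k` is the Markov transition from `E k` to `E (k+1)`, and `H k x y` is its density with respect
to a reference measure on `E (k+1)`.
-/

/-- The Snell envelope with multiplicative criteria, by backward recursion:
`snellAux M f G d k` is the value function at time `k` when `d` steps remain to the horizon,
`v = f` when `d = 0`, and `v = f ∨ (G · M v')` otherwise, `v'` being the value one step later. -/
def snellAux {E : ℕ → Type u} [∀ k, MeasurableSpace (E k)]
    (M : ∀ k, Kernel (E k) (E (k + 1))) (f G : ∀ k, E k → ℝ) :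
    ℕ → ∀ k, E k → ℝ
  | 0, k => f k
  | d + 1, k => fun x => max (f k x) (G k x * ∫ y, snellAux M f G d (k + 1) y ∂(M k x))

/-- `v_k` (for `k ≤ n`): `v_n = f_n` and `v_k = f_k ∨ (G_k · M_{k+1} v_{k+1})`. -/
def snell {E : ℕ → Type u} [∀ k, MeasurableSpace (E k)]
    (M : ∀ k, Kernel (E k) (E (k + 1))) (f G : ∀ k, E k → ℝ) (n k : ℕ) : E k → ℝ :=
  snellAux M f G (n - k) k

/-- `η^N(φ) = (1/N) ∑ i, φ (z i)`, the integral of `φ` against the occupation measure of the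
configuration `z`. -/
def empMean {N : ℕ} {X : Type u} (z : Fin N → X) (φ : X → ℝ) : ℝ :=
  (∑ i, φ (z i)) / N

/-- The Radon-Nikodym derivative of `Q_{k+1}(x, ·) = G_k(x) M_{k+1}(x, ·)` with respect to
`Φ_{k+1}(η)` at `y`, where `η` is the occupation measure of the configuration `z`:
`G_k(x) H_{k+1}(x, y) η(G_k) / η(G_k H_{k+1}(·, y))`. -/
def qDensity {N : ℕ} {X Y : Type u} (G : X → ℝ) (H : X → Y → ℝ) (z : Fin N → X)
    (x : X) (y : Y) : ℝ :=
  G x * H x y * empMean z G / empMean z (fun x' => G x' * H x' y)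

/-- The particle approximation of `snellAux` along a trajectory `z` of particle configurations:
`f` when no step remains, and otherwise
`f_k ∨ η^N_{k+1}( dQ_{k+1}(x, ·)/dΦ_{k+1}(η^N_k) · v' )`. -/
def snellHatAux {N : ℕ} {E : ℕ → Type u} (f G : ∀ k, E k → ℝ)
    (H : ∀ k, E k → E (k + 1) → ℝ) (z : ∀ k, Fin N → E k) :
    ℕ → ∀ k, E k → ℝ
  | 0, k => f k
  | d + 1, k => fun x => max (f k x)
      (empMean (z (k + 1)) fun y =>
        qDensity (G k) (H k) (z k) x y * snellHatAux f G H z d (k + 1) y)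

/-- The particle estimate `v̂_k` of `v_k` (for `k ≤ n`). -/
def snellHat {N : ℕ} {E : ℕ → Type u} (f G : ∀ k, E k → ℝ)
    (H : ∀ k, E k → E (k + 1) → ℝ) (n : ℕ) (z : ∀ k, Fin N → E k) (k : ℕ) : E k → ℝ :=
  snellHatAux f G H z (n - k) k

/-- Law of the `i`-th particle after selection from the configuration `z`: with probability
`s G(z i)` it stays at `z i`, otherwise it jumps to `z j` with probability
`G(z j) / ∑ l, G(z l)`. -/
def selection {N : ℕ} {X : Type u} [MeasurableSpace X] (G : X → ℝ) (s : ℝ)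
    (z : Fin N → X) (i : Fin N) : Measure X :=
  ENNReal.ofReal (s * G (z i)) • Measure.dirac (z i)
    + ENNReal.ofReal (1 - s * G (z i)) •
        ∑ j, ENNReal.ofReal (G (z j) / ∑ l, G (z l)) • Measure.dirac (z j)

/-- Law of the `i`-th particle after selection from the configuration `z` and mutation
by the transition `M`. -/
def particleStep {N : ℕ} {X Y : Type u} [MeasurableSpace X] [MeasurableSpace Y]
    (M : Kernel X Y) (G : X → ℝ) (s : ℝ) (z : Fin N → X) (i : Fin N) : Measure Y :=
  (selection G s z i).bind M

/-- `ξ` is the `N`-particle model up to time `n`: the initial particles are independent with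
law `η₀`, and for `k < n`, conditionally on the sigma-field `σ(ξ_0, …, ξ_k)`, the particles
`ξ_{k+1}^i` are independent, the `i`-th one having law `particleStep … (ξ_k) i`. -/
structure IsParticleModel {N : ℕ} {E : ℕ → Type u} [∀ k, MeasurableSpace (E k)]
    {Ω : Type*} [MeasurableSpace Ω] (P : Measure Ω) (n : ℕ) (η₀ : Measure (E 0))
    (M : ∀ k, Kernel (E k) (E (k + 1))) (G : ∀ k, E k → ℝ) (s : ℝ)
    (ξ : ∀ k, Ω → Fin N → E k) : Prop where
  measurable : ∀ k ≤ n, Measurable (ξ k)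
  init : P.map (ξ 0) = Measure.pi fun _ : Fin N => η₀
  step : ∀ k < n, ∀ B : Set Ω,
    MeasurableSet[⨆ j ≤ k, MeasurableSpace.comap (ξ j) inferInstance] B →
    ∀ A : Fin N → Set (E (k + 1)), (∀ i, MeasurableSet (A i)) →
      P (B ∩ {ω | ∀ i, ξ (k + 1) ω i ∈ A i})
        = ∫⁻ ω in B, ∏ i, particleStep (M k) (G k) s (ξ k ω) i (A i) ∂P

/-- Supremum norm `‖g‖` of a nonnegative function, with values in `[0, ∞]`. -/
def supNorm {X : Type u} (g : X → ℝ≥0∞) : ℝ≥0∞ := ⨆ x, g x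

/-- `h_{k+1}(y) = sup_{x, x'} H_{k+1}(x, y) / H_{k+1}(x', y)`, for `H = H_{k+1}`. -/
def oscRatio {X Y : Type u} (H : X → Y → ℝ) (y : Y) : ℝ≥0∞ :=
  ⨆ (x : X) (x' : X), ENNReal.ofReal (H x y / H x' y)

/-- `Q_{k,k+d}` acting on `[0, ∞]`-valued functions, with `Q_{k+1} φ (x) = G_k(x) M_{k+1} φ (x)`,
`Q_{k,k} = Id` and `Q_{k,l+1} = Q_{k,l} Q_{l+1}`. -/
def qIter {E : ℕ → Type u} [∀ k, MeasurableSpace (E k)]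
    (M : ∀ k, Kernel (E k) (E (k + 1))) (G : ∀ k, E k → ℝ) (k : ℕ) :
    ∀ d : ℕ, (E (k + d) → ℝ≥0∞) → E k → ℝ≥0∞
  | 0, φ => φ
  | d + 1, φ => qIter M G k d fun x => ENNReal.ofReal (G (k + d) x) * ∫⁻ y, φ y ∂(M (k + d) x)

/-- The smallest even integer greater than `p`. -/
def evenAbove (p : ℕ) : ℕ := 2 * (p / 2 + 1)

/-- `q_{k,l} = (‖G_l‖ ‖h_{k+1}‖ ∏_{m=k}^{l-1} ‖G_m‖)^{(p'-1)/p'}`. -/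
def qConst {E : ℕ → Type u} (G : ∀ k, E k → ℝ) (H : ∀ k, E k → E (k + 1) → ℝ)
    (p k l : ℕ) : ℝ≥0∞ :=
  (supNorm (fun x => ENNReal.ofReal (G l x)) * supNorm (oscRatio (H k))
      * ∏ m ∈ Finset.Ico k l, supNorm fun x => ENNReal.ofReal (G m x))
    ^ (((evenAbove p : ℝ) - 1) / (evenAbove p : ℝ))

/-- `∑_{k ≤ l < n} 2 q_{k,l} [Q_{k,l+1}(h_{l+1}^{p'-1} v_{l+1}^{p'})(x)]^{1/p'}`; the sum is
over `l = k + d`. -/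
def lpConst {E : ℕ → Type u} [∀ k, MeasurableSpace (E k)]
    (M : ∀ k, Kernel (E k) (E (k + 1))) (f G : ∀ k, E k → ℝ)
    (H : ∀ k, E k → E (k + 1) → ℝ) (n p k : ℕ) (x : E k) : ℝ≥0∞ :=
  ∑ d ∈ Finset.range (n - k),
    2 * qConst G H p k (k + d)
      * (qIter M G k (d + 1)
          (fun y : E (k + d + 1) => oscRatio (H (k + d)) y ^ (evenAbove p - 1)
            * ENNReal.ofReal (snell M f G n (k + d + 1) y ^ evenAbove p)) x)
        ^ (1 / (evenAbove p : ℝ))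

/-- The constant uniform in the exponent: the supremum of `lpConst` over all integers `p ≥ 1`. -/
def concConst {E : ℕ → Type u} [∀ k, MeasurableSpace (E k)]
    (M : ∀ k, Kernel (E k) (E (k + 1))) (f G : ∀ k, E k → ℝ)
    (H : ∀ k, E k → E (k + 1) → ℝ) (n k : ℕ) (x : E k) : ℝ≥0∞ :=
  ⨆ (p : ℕ) (_ : 1 ≤ p), lpConst M f G H n p k x

end PathSnell

end

namespace PathSnell

universe u

/-! ### One selection-mutation step -/

/-! The constant `concConst` is a supremum over all exponents `p`, so letting `p → ∞` turns the
`L^p`-type quantities in it into sup-norm quantities. With `K_l = qBase G H k l * ratioBound (H l)`,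
the bound evaluated at `v_{l+1}`, `sum_le_concConst` gives `2 ∑ K_l ≤ c`. Hence every random
quantity involved is almost surely bounded, and Hoeffding's lemma replaces moment estimates.

Given the configuration at time `l`, the estimate of `Q v` is an average of independent bounded
variables whose overall mean is exact, so the local error times `√N` is sub-Gaussian
(`lintegral_exp_localError_le`). Since `max` is 1-Lipschitz, the error at `k` is at most the local
error at `x` plus weighted empirical means of later local errors (`abs_snell_sub_snellHat_le_sum`).
Averaging over the particles cancels the density ratios exactly (`empMean_qDensity`), so only one
oscillation factor `‖h_{k+1}‖` appears.

These errors are dependent, but convexity of `exp` bounds the exponential moment of a weighted sum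
without independence. The Chernoff bound `measure_lt_le_of_sum_subgaussian` then concludes: the
factor 2 in `lpConst` leaves enough room to absorb both the shift `c/√N` and the factor 2 of the
two-sided estimate. -/

theorem sum_weights_eq_one {N : ℕ} {X : Type u} {G : X → ℝ} (hG : ∀ x, 0 < G x)
    (z : Fin N → X) (i : Fin N) :
    ∑ j, G (z j) / ∑ l, G (z l) = 1 := by
  rw [← Finset.sum_div, div_self]
  exact (Finset.sum_pos (fun j _ => hG (z j)) ⟨i, Finset.mem_univ i⟩).ne'

theorem qDensity_nonneg {N : ℕ} {X Y : Type u} {G : X → ℝ} {H : X → Y → ℝ} (hG : ∀ x, 0 < G x)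
    (hHpos : ∀ x y, 0 < H x y) (z : Fin N → X) (x : X) (y : Y) : 0 ≤ qDensity G H z x y := by
  have h1 := (hG x).le
  have h2 := (hHpos x y).le
  have h3 : 0 ≤ empMean z G :=
    div_nonneg (Finset.sum_nonneg fun i _ => (hG _).le) (Nat.cast_nonneg _)
  have h4 : 0 ≤ empMean z fun x' => G x' * H x' y :=
    div_nonneg (Finset.sum_nonneg fun i _ => mul_nonneg (hG _).le (hHpos _ _).le)
      (Nat.cast_nonneg _)
  unfold qDensity
  positivity

/-- Up to the factor `G x`, the density is the harmonic mean of the ratios `H x y / H (z i) y` with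
weights proportional to `G (z i)`, so it inherits any bound common to these ratios. -/
theorem qDensity_mul_le {N : ℕ} {X Y : Type u} {G : X → ℝ} {H : X → Y → ℝ} (hG : ∀ x, 0 < G x)
    (hHpos : ∀ x y, 0 < H x y) (hN : 0 < N) {z : Fin N → X} {x : X} {y : Y} {a b : ℝ}
    (hab : ∀ i, H x y / H (z i) y * a ≤ b) : qDensity G H z x y * a ≤ G x * b := by
  have hne : (Finset.univ : Finset (Fin N)).Nonempty := ⟨⟨0, hN⟩, Finset.mem_univ _⟩
  have hT : 0 < ∑ l, G (z l) * H (z l) y :=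
    Finset.sum_pos (fun j _ => mul_pos (hG (z j)) (hHpos _ _)) hne
  have hN' : (0 : ℝ) < N := by exact_mod_cast hN
  have key : H x y * a * ∑ l, G (z l) ≤ b * ∑ l, G (z l) * H (z l) y := by
    rw [Finset.mul_sum, Finset.mul_sum]
    refine Finset.sum_le_sum fun i _ => ?_
    have := hab i
    rw [div_mul_eq_mul_div, div_le_iff₀ (hHpos _ _)] at this
    nlinarith [mul_le_mul_of_nonneg_left this (hG (z i)).le]
  have e : qDensity G H z x y * a
      = G x * (H x y * a * (∑ l, G (z l)) / ∑ l, G (z l) * H (z l) y) := by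
    unfold qDensity empMean
    field_simp
  rw [e]
  refine mul_le_mul_of_nonneg_left ?_ (hG x).le
  rwa [div_le_iff₀ hT]

section Step

variable {N : ℕ} {X Y : Type u} [MeasurableSpace X] [MeasurableSpace Y]

theorem particleStep_eq (M : Kernel X Y) (G : X → ℝ) (s : ℝ) (z : Fin N → X) (i : Fin N) :
    particleStep M G s z i = ENNReal.ofReal (s * G (z i)) • M (z i)
      + ENNReal.ofReal (1 - s * G (z i)) •
        ∑ j, ENNReal.ofReal (G (z j) / ∑ l, G (z l)) • M (z j) := by
  ext A hA
  have hm : Measurable fun x => M x A := M.measurable_coe hA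
  rw [particleStep, Measure.bind_apply hA M.aemeasurable, selection]
  simp [lintegral_add_measure, lintegral_smul_measure, lintegral_dirac' _ hm]

theorem isProbabilityMeasure_particleStep (M : Kernel X Y) [IsMarkovKernel M] {G : X → ℝ}
    (hG : ∀ x, 0 < G x) {s : ℝ} (hs : ∀ x, s * G x ∈ Icc (0 : ℝ) 1) (z : Fin N → X)
    (i : Fin N) : IsProbabilityMeasure (particleStep M G s z i) := by
  constructor
  have h1 : ∑ j, ENNReal.ofReal (G (z j) / ∑ l, G (z l)) = 1 := by
    rw [← ENNReal.ofReal_sum_of_nonneg, sum_weights_eq_one hG z i, ENNReal.ofReal_one]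
    exact fun j _ => div_nonneg (hG _).le (Finset.sum_nonneg fun l _ => (hG _).le)
  rw [particleStep_eq]
  simp only [Measure.add_apply, Measure.smul_apply, Measure.finsetSum_apply, measure_univ,
    smul_eq_mul, mul_one, h1]
  rw [← ENNReal.ofReal_add (hs _).1 (by linarith [(hs (z i)).2])]
  simp

theorem particleStep_absolutelyContinuous {M : Kernel X Y} {μ : Measure Y}
    (hM : ∀ x, M x ≪ μ) (G : X → ℝ) (s : ℝ) (z : Fin N → X) (i : Fin N) :
    particleStep M G s z i ≪ μ := by
  intro A hA
  rw [particleStep_eq]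
  simp [hM _ hA]

/-- The acceptance terms add up to `s (∑ G) Ψ`, where `Ψ` is the resampling mean; this is exactly
what the rejection terms `(N - s ∑ G) Ψ` lack. The parameter `s` therefore cancels. -/
theorem sum_integral_particleStep {M : Kernel X Y} {G : X → ℝ}
    (hG : ∀ x, 0 < G x) {s : ℝ} (hs : ∀ x, s * G x ∈ Icc (0 : ℝ) 1) (z : Fin N → X)
    {φ : Y → ℝ} (hφ : ∀ i, Integrable φ (M (z i))) :
    ∑ i, ∫ y, φ y ∂(particleStep M G s z i)
      = N * ∑ j, G (z j) / (∑ l, G (z l)) * ∫ y, φ y ∂(M (z j)) := by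
  rcases Nat.eq_zero_or_pos N with rfl | hN
  · simp
  have hS : 0 < ∑ l, G (z l) := Finset.sum_pos (fun j _ => hG (z j)) ⟨⟨0, hN⟩, Finset.mem_univ _⟩
  have hw : ∀ j, 0 ≤ G (z j) / ∑ l, G (z l) := fun j => div_nonneg (hG _).le hS.le
  have hi : ∀ i, ∫ y, φ y ∂(particleStep M G s z i)
      = s * G (z i) * ∫ y, φ y ∂(M (z i))
        + (1 - s * G (z i)) * ∑ j, G (z j) / (∑ l, G (z l)) * ∫ y, φ y ∂(M (z j)) := by
    intro i
    have hj : ∀ j, Integrable φ (ENNReal.ofReal (G (z j) / ∑ l, G (z l)) • M (z j)) :=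
      fun j => (hφ j).smul_measure ENNReal.ofReal_ne_top
    rw [particleStep_eq, integral_add_measure, integral_smul_measure, integral_smul_measure,
      integral_finsetSum_measure (fun j _ => hj j)]
    · simp only [integral_smul_measure, ENNReal.toReal_ofReal (hw _),
        ENNReal.toReal_ofReal (hs _).1, smul_eq_mul,
        ENNReal.toReal_ofReal (sub_nonneg.2 (hs (z i)).2)]
    · exact (hφ i).smul_measure ENNReal.ofReal_ne_top
    · refine Integrable.smul_measure ?_ ENNReal.ofReal_ne_top
      exact integrable_finsetSum_measure.2 fun j _ => hj j
  simp_rw [hi]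
  set Ψ := ∑ j, G (z j) / (∑ l, G (z l)) * ∫ y, φ y ∂(M (z j)) with hΨ
  have h2 : ∑ i, s * G (z i) * ∫ y, φ y ∂(M (z i)) = s * (∑ l, G (z l)) * Ψ := by
    rw [hΨ, Finset.mul_sum]
    refine Finset.sum_congr rfl fun i _ => ?_
    field_simp
  rw [Finset.sum_add_distrib, h2, ← Finset.sum_mul, Finset.sum_sub_distrib, ← Finset.mul_sum]
  simp
  ring

/-- The mean of the particle laws, tested on `qDensity x · v`, is `G x * M v x`. -/
theorem sum_integral_particleStep_qDensity {M : Kernel X Y} {G : X → ℝ} {H : X → Y → ℝ}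
    {μ : Measure Y} (hG : ∀ x, 0 < G x) {s : ℝ} (hs : ∀ x, s * G x ∈ Icc (0 : ℝ) 1)
    (hH : Measurable (Function.uncurry H)) (hHpos : ∀ x y, 0 < H x y)
    (hMH : ∀ x, M x = μ.withDensity fun y => ENNReal.ofReal (H x y))
    (x : X) (z : Fin N → X) {v : Y → ℝ}
    (hq : ∀ i, Integrable (fun y => qDensity G H z x y * v y) (M (z i))) :
    ∑ i, ∫ y, qDensity G H z x y * v y ∂(particleStep M G s z i)
      = N * (G x * ∫ y, v y ∂(M x)) := by
  rcases Nat.eq_zero_or_pos N with rfl | hN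
  · simp
  have hne : (Finset.univ : Finset (Fin N)).Nonempty := ⟨⟨0, hN⟩, Finset.mem_univ _⟩
  have hS : 0 < ∑ l, G (z l) := Finset.sum_pos (fun j _ => hG (z j)) hne
  have hT : ∀ y, 0 < ∑ l, G (z l) * H (z l) y := fun y =>
    Finset.sum_pos (fun j _ => mul_pos (hG (z j)) (hHpos _ _)) hne
  have hHx : ∀ x, Measurable (H x) := fun x => hH.comp measurable_prodMk_left
  have hwd : ∀ x (g : Y → ℝ), ∫ y, g y ∂(M x) = ∫ y, H x y * g y ∂μ := by
    intro x g
    rw [hMH, integral_withDensity_eq_integral_toReal_smul (hHx x).ennreal_ofReal (by simp)]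
    simp [ENNReal.toReal_ofReal (hHpos _ _).le]
  have hwi : ∀ x (g : Y → ℝ), Integrable g (M x) → Integrable (fun y => H x y * g y) μ := by
    intro x g hg
    rw [hMH, integrable_withDensity_iff_integrable_smul' (hHx x).ennreal_ofReal (by simp)] at hg
    simpa [ENNReal.toReal_ofReal (hHpos _ _).le] using hg
  rw [sum_integral_particleStep hG hs z hq]
  simp_rw [hwd, ← integral_const_mul]
  rw [← integral_finsetSum _ fun j _ => (hwi _ _ (hq j)).const_mul _]
  rw [← integral_const_mul]
  congr 1
  funext y
  have := (hT y).ne'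
  have := hS.ne'
  have hN' : (N : ℝ) ≠ 0 := by positivity
  -- After summing over `j`, the factors `G (z j) * H (z j) y` rebuild the denominator of
  -- `qDensity`, leaving only `H x y * v y`.
  have e1 : ∀ j, G (z j) / (∑ l, G (z l)) * (H (z j) y * (qDensity G H z x y * v y))
      = G (z j) * H (z j) y * (qDensity G H z x y * v y / ∑ l, G (z l)) := fun j => by
    field_simp
  simp_rw [e1]
  rw [← Finset.sum_mul, qDensity, empMean, empMean]
  field_simp

theorem measurable_qDensity {G : X → ℝ} {H : X → Y → ℝ} (hG : Measurable G)
    (hH : Measurable (Function.uncurry H)) :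
    Measurable fun p : (Fin N → X) × X × Y => qDensity G H p.1 p.2.1 p.2.2 := by
  have e : ∀ i, Measurable fun p : (Fin N → X) × X × Y => p.1 i := fun i => by fun_prop
  have hH' : ∀ {g : (Fin N → X) × X × Y → X}, Measurable g →
      Measurable fun p => H (g p) p.2.2 := fun hg =>
    hH.comp (hg.prodMk (measurable_snd.comp measurable_snd))
  unfold qDensity empMean
  refine Measurable.div (Measurable.mul (Measurable.mul ?_ (hH' ?_)) ?_) ?_
  · exact hG.comp (measurable_fst.comp measurable_snd)
  · exact measurable_fst.comp measurable_snd
  · exact (Finset.measurable_sum _ fun i _ => hG.comp (e i)).div_const _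
  · exact (Finset.measurable_sum _ fun i _ => (hG.comp (e i)).mul (hH' (e i))).div_const _

/-- The local error, at the point `x`, of the particle approximation of `Q v`. -/
noncomputable def localError (M : Kernel X Y) (G : X → ℝ) (H : X → Y → ℝ) (v : Y → ℝ)
    (z : Fin N → X) (z' : Fin N → Y) (x : X) : ℝ :=
  |(empMean z' fun y => qDensity G H z x y * v y) - G x * ∫ y, v y ∂(M x)|

theorem measurable_localError {Ω : Type*} [MeasurableSpace Ω] (M : Kernel X Y)
    [IsSFiniteKernel M] {G : X → ℝ} {H : X → Y → ℝ}
    {v : Y → ℝ} (hG : Measurable G) (hH : Measurable (Function.uncurry H)) (hv : Measurable v)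
    {Z : Ω → Fin N → X} {Z' : Ω → Fin N → Y} {A : Ω → X} (hZ : Measurable Z)
    (hZ' : Measurable Z') (hA : Measurable A) :
    Measurable fun ω => localError M G H v (Z ω) (Z' ω) (A ω) := by
  unfold localError empMean
  have hy : ∀ i, Measurable fun ω => Z' ω i := fun i => by fun_prop
  refine Measurable.abs (Measurable.sub (Measurable.div_const
    (Finset.measurable_sum _ fun i _ => Measurable.mul ?_ (hv.comp (hy i))) _)
    ((hG.comp hA).mul ?_))
  · exact (measurable_qDensity hG hH).comp (hZ.prodMk (hA.prodMk (hy i)))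
  · exact (StronglyMeasurable.integral_kernel (κ := M) hv.stronglyMeasurable).measurable.comp hA

/-- Under the law of one particle step, the local error is sub-Gaussian. -/
theorem lintegral_exp_localError_le {M : Kernel X Y} [IsMarkovKernel M] {G : X → ℝ}
    {H : X → Y → ℝ} {μ : Measure Y} (hGm : Measurable G) (hG : ∀ x, 0 < G x) {s : ℝ}
    (hs : ∀ x, s * G x ∈ Icc (0 : ℝ) 1)
    (hH : Measurable (Function.uncurry H)) (hHpos : ∀ x y, 0 < H x y)
    (hMH : ∀ x, M x = μ.withDensity fun y => ENNReal.ofReal (H x y)) {v : Y → ℝ}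
    (hv : Measurable v) (x : X) (z : Fin N → X) {b : ℝ} (hN : 0 < N)
    (hb : ∀ᵐ y ∂μ, |qDensity G H z x y * v y| ≤ b) {t : ℝ} (ht : 0 ≤ t) :
    ∫⁻ y, ENNReal.ofReal (Real.exp (t * (√(N : ℝ) * localError M G H v z y x)))
        ∂(Measure.pi fun i => particleStep M G s z i)
      ≤ ENNReal.ofReal (2 * Real.exp (t ^ 2 * b ^ 2 / 2)) := by
  have hp : ∀ i, IsProbabilityMeasure (particleStep M G s z i) :=
    isProbabilityMeasure_particleStep M hG hs z
  have hMμ : ∀ x, M x ≪ μ := fun x => by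
    rw [hMH]; exact withDensity_absolutelyContinuous _ _
  set φ : Y → ℝ := fun y => qDensity G H z x y * v y with hφ
  have hφm : Measurable φ :=
    ((measurable_qDensity hGm hH).comp (measurable_const.prodMk
      (measurable_const.prodMk measurable_id))).mul hv
  have hφb : ∀ i, ∀ᵐ y ∂(particleStep M G s z i), φ y ∈ Icc (-b) b := fun i =>
    (particleStep_absolutelyContinuous hMμ G s z i) (hb.mono fun y hy => abs_le.1 hy)
  have hφi : ∀ i, Integrable φ (M (z i)) := fun i =>
    Integrable.of_bound hφm.aestronglyMeasurable b ((hMμ _) hb)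
  have hsum := sum_integral_particleStep_qDensity (s := s) hG hs hH hHpos hMH x z hφi
  set m : ℝ := G x * ∫ y, v y ∂(M x) with hm
  set P := Measure.pi fun i => particleStep M G s z i with hP
  -- Hoeffding's lemma on `[-b, b]`: the variance proxy is `b ^ 2`, the same for all particles
  -- although their laws differ.
  have hsub : ∀ i, HasSubgaussianMGF
      (fun y : Fin N → Y => φ (y i) - ∫ y, φ y ∂(particleStep M G s z i))
      ((‖b - -b‖₊ / 2) ^ 2) P := by
    intro i
    have h := hasSubgaussianMGF_of_mem_Icc hφm.aemeasurable (hφb i)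
    have hmp := measurePreserving_eval (fun i => particleStep M G s z i) i
    rw [← hmp.map_eq] at h
    have h2 := HasSubgaussianMGF.of_map hmp.measurable.aemeasurable h
    rw [hmp.map_eq] at h2
    exact h2
  have hind : iIndepFun
      (fun (i : Fin N) (y : Fin N → Y) => φ (y i) - ∫ y, φ y ∂(particleStep M G s z i)) P :=
    iIndepFun_pi (X := fun i y => φ y - ∫ y, φ y ∂(particleStep M G s z i))
      fun i => (hφm.sub_const _).aemeasurable
  have hS := HasSubgaussianMGF.sum_of_iIndepFun hind (s := Finset.univ) fun i _ => hsub i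
  set S : (Fin N → Y) → ℝ := fun y =>
    ∑ i, (φ (y i) - ∫ y, φ y ∂(particleStep M G s z i)) with hSdef
  have hN' : (0 : ℝ) < N := by exact_mod_cast hN
  -- The sum of `N` independent terms has proxy `N b ^ 2`; the argument `r / √N` removes `N`.
  have hmgf : ∀ r : ℝ, ∫⁻ y, ENNReal.ofReal (Real.exp (r / √(N : ℝ) * S y)) ∂P
      ≤ ENNReal.ofReal (Real.exp (r ^ 2 * b ^ 2 / 2)) := by
    intro r
    rw [← ofReal_integral_eq_lintegral_ofReal (hS.integrable_exp_mul _)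
      (ae_of_all _ fun _ => (Real.exp_pos _).le)]
    refine ENNReal.ofReal_le_ofReal ((hS.mgf_le (r / √(N : ℝ))).trans (le_of_eq ?_))
    congr 1
    have hb2 : ((‖b - -b‖₊ / 2 : NNReal) : ℝ) ^ 2 = b ^ 2 := by
      rw [sub_neg_eq_add]
      push_cast
      rw [Real.norm_eq_abs, div_pow, sq_abs]
      ring
    simp only [Finset.sum_const, Finset.card_univ, Fintype.card_fin, nsmul_eq_mul]
    rw [NNReal.coe_mul, NNReal.coe_pow, hb2, NNReal.coe_natCast, div_pow, Real.sq_sqrt hN'.le]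
    field_simp
  have hpt : ∀ y, t * (√(N : ℝ) * localError M G H v z y x) = |t / √(N : ℝ) * S y| := by
    intro y
    have hsq : √(N : ℝ) * √(N : ℝ) = N := Real.mul_self_sqrt hN'.le
    have hsp : 0 < √(N : ℝ) := Real.sqrt_pos.2 hN'
    have hSy : S y = N * ((empMean y φ) - m) := by
      rw [hSdef]
      simp only [Finset.sum_sub_distrib]
      rw [show ∑ i, ∫ y, φ y ∂(particleStep M G s z i) = N * m from hsum, empMean]
      field_simp
    rw [hSy, abs_mul, abs_mul, abs_of_nonneg (by positivity : 0 ≤ t / √(N : ℝ)),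
      abs_of_pos hN', localError]
    field_simp
    rw [Real.sq_sqrt hN'.le]
  -- `exp |u| ≤ exp u + exp (-u)`: the source of the factor 2.
  calc _ ≤ ∫⁻ y, (ENNReal.ofReal (Real.exp (t / √(N : ℝ) * S y))
        + ENNReal.ofReal (Real.exp (-t / √(N : ℝ) * S y))) ∂P := by
        refine lintegral_mono fun y => ?_
        rw [hpt, ← ENNReal.ofReal_add (Real.exp_pos _).le (Real.exp_pos _).le]
        refine ENNReal.ofReal_le_ofReal ?_
        rw [neg_div, neg_mul]
        rcases abs_cases (t / √(N : ℝ) * S y) with ⟨h, _⟩ | ⟨h, _⟩ <;> rw [h]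
        · linarith [Real.exp_pos (-(t / √(N : ℝ) * S y))]
        · linarith [Real.exp_pos (t / √(N : ℝ) * S y)]
    _ ≤ ENNReal.ofReal (Real.exp (t ^ 2 * b ^ 2 / 2))
        + ENNReal.ofReal (Real.exp (t ^ 2 * b ^ 2 / 2)) := by
        have hSm : Measurable S := Finset.measurable_sum _ fun i _ =>
          (hφm.comp (measurable_pi_apply i)).sub_const _
        have hem : Measurable fun y => ENNReal.ofReal (Real.exp (t / √(N : ℝ) * S y)) :=
          (Real.measurable_exp.comp (hSm.const_mul _)).ennreal_ofReal
        rw [lintegral_add_left hem]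
        refine add_le_add (hmgf t) ?_
        simpa using hmgf (-t)
    _ = _ := by
        rw [← ENNReal.ofReal_add (Real.exp_pos _).le (Real.exp_pos _).le, two_mul]

/-- The local error vanishes almost surely when `qDensity x · v` does. -/
theorem lintegral_localError_eq_zero {M : Kernel X Y} [IsMarkovKernel M] {G : X → ℝ}
    {H : X → Y → ℝ} {μ : Measure Y} (hG : ∀ x, 0 < G x) {s : ℝ}
    (hs : ∀ x, s * G x ∈ Icc (0 : ℝ) 1)
    (hH : Measurable (Function.uncurry H)) (hHpos : ∀ x y, 0 < H x y)
    (hMH : ∀ x, M x = μ.withDensity fun y => ENNReal.ofReal (H x y)) {v : Y → ℝ}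
    (x : X) (z : Fin N → X) (hN : 0 < N)
    (hb : ∀ᵐ y ∂μ, qDensity G H z x y * v y = 0) :
    ∫⁻ y, ENNReal.ofReal (localError M G H v z y x)
        ∂(Measure.pi fun i => particleStep M G s z i) = 0 := by
  have hp : ∀ i, IsProbabilityMeasure (particleStep M G s z i) :=
    isProbabilityMeasure_particleStep M hG hs z
  have hMμ : ∀ x, M x ≪ μ := fun x => by
    rw [hMH]; exact withDensity_absolutelyContinuous _ _
  have hb' : ∀ i, (fun y => qDensity G H z x y * v y) =ᵐ[particleStep M G s z i] 0 := fun i =>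
    (particleStep_absolutelyContinuous hMμ G s z i) hb
  have hsum := sum_integral_particleStep_qDensity (s := s) hG hs hH hHpos hMH x z (v := v) fun i =>
      (integrable_zero _ _ _).congr (Filter.EventuallyEq.symm ((hMμ _) hb))
  have hN' : (N : ℝ) ≠ 0 := by positivity
  rw [Finset.sum_eq_zero fun i _ => integral_eq_zero_of_ae (hb' i)] at hsum
  have hm : G x * ∫ y, v y ∂(M x) = 0 := by
    rcases mul_eq_zero.1 hsum.symm with h | h
    · exact absurd h hN'
    · exact h
  have hae : ∀ᵐ y ∂(Measure.pi fun i => particleStep M G s z i),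
      ∀ i, qDensity G H z x (y i) * v (y i) = 0 :=
    ae_all_iff.2 fun i => Measure.tendsto_eval_ae_ae.eventually (hb' i)
  refine (lintegral_congr_ae (hae.mono fun y hy => ?_)).trans lintegral_zero
  simp [localError, hm, empMean, hy]

end Step

/-! ### A lower bound for the concentration constant -/

/-- The smallest constant dominating `H(a, ·) / H(a', ·) · |v|` almost everywhere, for all `a, a'`. -/
noncomputable def ratioBound {X Y : Type u} [MeasurableSpace Y] (H : X → Y → ℝ) (μ : Measure Y)
    (v : Y → ℝ) : ℝ≥0∞ :=
  ⨆ (a : X) (a' : X), essSup (fun y => ENNReal.ofReal (H a y / H a' y * |v y|)) μ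

theorem ae_le_ratioBound {X Y : Type u} [MeasurableSpace Y] (H : X → Y → ℝ) (μ : Measure Y)
    (v : Y → ℝ) (a a' : X) :
    ∀ᵐ y ∂μ, ENNReal.ofReal (H a y / H a' y * |v y|) ≤ ratioBound H μ v := by
  filter_upwards [ae_le_essSup (μ := μ)
    (f := fun y => ENNReal.ofReal (H a y / H a' y * |v y|))] with y hy
  exact hy.trans (le_iSup₂ (f := fun a a' =>
    essSup (fun y => ENNReal.ofReal (H a y / H a' y * |v y|)) μ) a a')

theorem oscRatio_ge {X Y : Type u} (H : X → Y → ℝ) (a a' : X) (y : Y) :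
    ENNReal.ofReal (H a y / H a' y) ≤ oscRatio H y :=
  le_iSup₂ (f := fun a a' => ENNReal.ofReal (H a y / H a' y)) a a'

section Iter

variable {E : ℕ → Type u} [∀ k, MeasurableSpace (E k)]

theorem qIter_mono (M : ∀ k, Kernel (E k) (E (k + 1))) (G : ∀ k, E k → ℝ) (k d : ℕ)
    {φ ψ : E (k + d) → ℝ≥0∞} (h : φ ≤ ψ) : qIter M G k d φ ≤ qIter M G k d ψ := by
  induction d with
  | zero => exact h
  | succ d ih => exact ih fun x => mul_le_mul_right (lintegral_mono h) _

theorem qIter_const_mul (M : ∀ k, Kernel (E k) (E (k + 1))) (G : ∀ k, E k → ℝ) (k d : ℕ)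
    {r : ℝ≥0∞} (hr : r ≠ ∞) (φ : E (k + d) → ℝ≥0∞) (x : E k) :
    qIter M G k d (fun y => r * φ y) x = r * qIter M G k d φ x := by
  induction d with
  | zero => rfl
  | succ d ih =>
    simp only [qIter]
    rw [← ih]
    congr 1
    funext y
    rw [lintegral_const_mul' _ _ hr, mul_left_comm]

theorem qIter_pos {M : ∀ k, Kernel (E k) (E (k + 1))} {G : ∀ k, E k → ℝ} {n k : ℕ} (d : ℕ)
    (hd : k + d ≤ n) (hM : ∀ k < n, IsMarkovKernel (M k))
    (hG : ∀ k < n, Measurable (G k)) (hGpos : ∀ k < n, ∀ x, 0 < G k x)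
    {φ : E (k + d) → ℝ≥0∞} (hφ : Measurable φ) (hpos : ∀ y, 0 < φ y) (x : E k) :
    0 < qIter M G k d φ x := by
  induction d with
  | zero => exact hpos x
  | succ d ih =>
    have hlt : k + d < n := by omega
    have := hM _ hlt
    refine ih hlt.le ((hG _ hlt).ennreal_ofReal.mul hφ.lintegral_kernel) fun y => ?_
    refine ENNReal.mul_pos (by simpa using hGpos _ hlt y) ?_
    refine ((lintegral_pos_iff_support hφ).2 ?_).ne'
    have : Function.support φ = univ := eq_univ_of_forall fun y => (hpos y).ne'
    simp [this]

/-- The last transition charges every set that `μ` charges, so it makes the function positive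
everywhere; `qIter_pos` handles the remaining steps. -/
theorem qIter_succ_pos {M : ∀ k, Kernel (E k) (E (k + 1))} {G : ∀ k, E k → ℝ} {n k : ℕ} (d : ℕ)
    (hd : k + d < n) (hM : ∀ k < n, IsMarkovKernel (M k))
    (hG : ∀ k < n, Measurable (G k)) (hGpos : ∀ k < n, ∀ x, 0 < G k x)
    {μ : Measure (E (k + d + 1))} (hμ : ∀ y, μ ≪ M (k + d) y)
    {φ : E (k + d + 1) → ℝ≥0∞} (hφ : Measurable φ) (hpos : μ (Function.support φ) ≠ 0)
    (x : E k) : 0 < qIter M G k (d + 1) φ x := by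
  refine qIter_pos d hd.le hM hG hGpos ((hG _ hd).ennreal_ofReal.mul hφ.lintegral_kernel)
    (fun y => ?_) x
  refine ENNReal.mul_pos (by simpa using hGpos _ hd y) ?_
  refine ((lintegral_pos_iff_support hφ).2 (pos_iff_ne_zero.2 fun h => hpos (hμ y h))).ne'

theorem evenAbove_even (p : ℕ) : Even (evenAbove p) := ⟨p / 2 + 1, by unfold evenAbove; ring⟩

theorem two_le_evenAbove (p : ℕ) : 2 ≤ evenAbove p := by unfold evenAbove; omega

theorem tendsto_inv_evenAbove :
    Filter.Tendsto (fun p => 1 / (evenAbove p : ℝ)) Filter.atTop (nhds 0) := by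
  refine squeeze_zero (fun p => by positivity) (fun p => ?_) tendsto_one_div_add_atTop_nhds_zero_nat
  refine one_div_le_one_div_of_le (by positivity) ?_
  have : p + 1 ≤ evenAbove p := by unfold evenAbove; omega
  exact_mod_cast this

/-- The integrals entering `lpConst` grow at least like the powers of any number smaller than
`ratioBound`. -/
theorem exists_pow_mul_le_qIter {M : ∀ k, Kernel (E k) (E (k + 1))} {G : ∀ k, E k → ℝ}
    {H : ∀ k, E k → E (k + 1) → ℝ} {n k : ℕ} (d : ℕ)
    (hd : k + d < n) (hM : ∀ k < n, IsMarkovKernel (M k))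
    (hG : ∀ k < n, Measurable (G k)) (hGpos : ∀ k < n, ∀ x, 0 < G k x)
    {μ : Measure (E (k + d + 1))} (hμ : ∀ y, μ ≪ M (k + d) y)
    (hH : Measurable (Function.uncurry (H (k + d)))) (hHpos : ∀ x y, 0 < H (k + d) x y)
    {v : E (k + d + 1) → ℝ} (hv : Measurable v) {b : ℝ≥0∞}
    (hb : b < ratioBound (H (k + d)) μ v) (x : E k) :
    ∃ δ : ℝ≥0∞, δ ≠ 0 ∧ δ ≠ ∞ ∧ ∀ p : ℕ, b ^ evenAbove p * δ ≤
      qIter M G k (d + 1) (fun y : E (k + d + 1) =>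
        oscRatio (H (k + d)) y ^ (evenAbove p - 1) * ENNReal.ofReal (v y ^ evenAbove p)) x := by
  obtain ⟨a, ha⟩ := lt_iSup_iff.1 hb
  obtain ⟨a', ha'⟩ := lt_iSup_iff.1 ha
  have hHx : ∀ x, Measurable (H (k + d) x) := fun x => hH.comp measurable_prodMk_left
  set h : E (k + d + 1) → ℝ≥0∞ := fun y => ENNReal.ofReal (H (k + d) a y / H (k + d) a' y) with hh
  have hhm : Measurable h := ((hHx a).div (hHx a')).ennreal_ofReal
  have hh0 : ∀ y, h y ≠ 0 := fun y => by
    simpa [hh] using div_pos (hHpos a y) (hHpos a' y)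
  have hht : ∀ y, h y ≠ ∞ := fun y => ENNReal.ofReal_ne_top
  set S : Set (E (k + d + 1)) := {y | b < h y * ENNReal.ofReal |v y|} with hS
  have hSm : MeasurableSet S :=
    measurableSet_lt measurable_const (hhm.mul hv.abs.ennreal_ofReal)
  have hSμ : μ S ≠ 0 := by
    intro h0
    refine ha'.not_ge (essSup_le_of_ae_le _ ?_)
    have : ∀ᵐ y ∂μ, y ∉ S := measure_eq_zero_iff_ae_notMem.1 h0
    filter_upwards [this] with y hy
    rw [ENNReal.ofReal_mul (div_pos (hHpos a y) (hHpos a' y)).le]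
    exact not_lt.1 hy
  -- The weight `1 / h` lowers `h ^ p'` to the power `h ^ (p' - 1)` present in the integrand, while
  -- `ψ` itself does not depend on `p`.
  set ψ : E (k + d + 1) → ℝ≥0∞ := S.indicator fun y => (h y)⁻¹ with hψ
  have hψm : Measurable ψ := hhm.inv.indicator hSm
  have hpos : 0 < qIter M G k (d + 1) ψ x := by
    refine qIter_succ_pos d hd hM hG hGpos hμ hψm ?_ x
    have : Function.support ψ = S := by
      ext y
      by_cases hy : y ∈ S <;> simp [hψ, hy, hht y]
    rwa [this]
  have hbt : b ≠ ∞ := hb.ne_top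
  -- The minimum with 1 keeps `δ` finite, since the integral of `ψ` may be infinite.
  refine ⟨min 1 (qIter M G k (d + 1) ψ x), (lt_min one_pos hpos).ne',
    ((min_le_left _ _).trans_lt ENNReal.one_lt_top).ne, fun p => ?_⟩
  refine (mul_le_mul_right (min_le_right _ _) _).trans ?_
  rw [← qIter_const_mul M G k (d + 1) (ENNReal.pow_ne_top hbt)]
  refine qIter_mono M G k (d + 1) (fun y => ?_) x
  by_cases hy : y ∈ S
  -- Evenness of the exponent makes the sign of `v` irrelevant; `ENNReal.ofReal` would otherwise
  -- truncate.
  · have e1 : ENNReal.ofReal (v y ^ evenAbove p) = ENNReal.ofReal |v y| ^ evenAbove p := by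
      rw [← ENNReal.ofReal_pow (abs_nonneg _), (evenAbove_even p).pow_abs]
    have h1 : b ^ evenAbove p ≤ (h y * ENNReal.ofReal |v y|) ^ evenAbove p :=
      pow_le_pow_left₀ (by positivity) (le_of_lt hy) _
    have e2 : h y ^ evenAbove p * (h y)⁻¹ = h y ^ (evenAbove p - 1) := by
      obtain ⟨m, hm⟩ : ∃ m, evenAbove p = m + 1 := ⟨evenAbove p - 1, by
        have := two_le_evenAbove p; omega⟩
      rw [hm, pow_succ, mul_assoc, ENNReal.mul_inv_cancel (hh0 y) (hht y), mul_one]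
      rfl
    simp only [hψ, indicator_of_mem hy]
    rw [e1]
    calc b ^ evenAbove p * (h y)⁻¹
        ≤ (h y * ENNReal.ofReal |v y|) ^ evenAbove p * (h y)⁻¹ := mul_le_mul_left h1 _
      _ = h y ^ (evenAbove p - 1) * ENNReal.ofReal |v y| ^ evenAbove p := by
          rw [mul_pow, mul_right_comm, e2]
      _ ≤ _ := mul_le_mul_left (pow_le_pow_left₀ (by positivity) (oscRatio_ge _ a a' y) _) _
  · simp [hψ, hy]

theorem tendsto_const_rpow {r : ℝ≥0∞} (h0 : r ≠ 0) (ht : r ≠ ∞) {u : ℕ → ℝ} {a : ℝ}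
    (hu : Filter.Tendsto u Filter.atTop (nhds a)) :
    Filter.Tendsto (fun p => r ^ u p) Filter.atTop (nhds (r ^ a)) := by
  lift r to NNReal using ht
  have h0' : r ≠ 0 := by simpa using h0
  simp_rw [← ENNReal.coe_rpow_of_ne_zero h0']
  exact ENNReal.tendsto_coe.2 (tendsto_const_nhds.nnrpow hu (Or.inl h0'))

/-- The factor `‖G_l‖ ‖h_{k+1}‖ ∏_{m=k}^{l-1} ‖G_m‖`, whose powers are `qConst`. -/
noncomputable def qBase (G : ∀ k, E k → ℝ) (H : ∀ k, E k → E (k + 1) → ℝ) (k l : ℕ) : ℝ≥0∞ :=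
  supNorm (fun x => ENNReal.ofReal (G l x)) * supNorm (oscRatio (H k))
      * ∏ m ∈ Finset.Ico k l, supNorm fun x => ENNReal.ofReal (G m x)

/-- The exponent `(p' - 1) / p'` tends to 1, and the `p'`-th root of the integral is at least `b * δ
^ (1 / p')`, which tends to `b`. Working with `κ` and `b` strictly below the two suprema keeps both
finite, even where `qBase` or `ratioBound` is infinite. -/
theorem le_liminf_lpConst_term {M : ∀ k, Kernel (E k) (E (k + 1))} {f G : ∀ k, E k → ℝ}
    {H : ∀ k, E k → E (k + 1) → ℝ} {n k : ℕ} (d : ℕ)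
    (hd : k + d < n) (hM : ∀ k < n, IsMarkovKernel (M k))
    (hG : ∀ k < n, Measurable (G k)) (hGpos : ∀ k < n, ∀ x, 0 < G k x)
    {μ : Measure (E (k + d + 1))} (hμ : ∀ y, μ ≪ M (k + d) y)
    (hH : Measurable (Function.uncurry (H (k + d)))) (hHpos : ∀ x y, 0 < H (k + d) x y)
    (hv : Measurable (snell M f G n (k + d + 1))) (x : E k) :
    2 * (qBase G H k (k + d) * ratioBound (H (k + d)) μ (snell M f G n (k + d + 1))) ≤
      Filter.liminf (fun p : ℕ => 2 * qConst G H p k (k + d)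
      * (qIter M G k (d + 1)
          (fun y : E (k + d + 1) => oscRatio (H (k + d)) y ^ (evenAbove p - 1)
            * ENNReal.ofReal (snell M f G n (k + d + 1) y ^ evenAbove p)) x)
        ^ (1 / (evenAbove p : ℝ))) Filter.atTop := by
  rw [← mul_assoc]
  refine ENNReal.mul_le_of_forall_lt fun c hc b hb => ?_
  rw [mul_comm, ← ENNReal.div_lt_iff (by simp) (by simp)] at hc
  obtain ⟨κ, hcκ, hκ⟩ := exists_between hc
  have hκ0 : κ ≠ 0 := (pos_of_gt hcκ).ne'
  have hκt : κ ≠ ∞ := hκ.ne_top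
  rw [ENNReal.div_lt_iff (by simp) (by simp), mul_comm] at hcκ
  refine (mul_le_mul_left hcκ.le b).trans ?_
  obtain ⟨δ, hδ0, hδt, hδ⟩ := exists_pow_mul_le_qIter d hd hM hG hGpos hμ hH hHpos hv hb x
  have hu := tendsto_inv_evenAbove
  have hlim : Filter.Tendsto (fun p => 2 * κ ^ (1 - 1 / (evenAbove p : ℝ)) *
      (b * δ ^ (1 / (evenAbove p : ℝ)))) Filter.atTop (nhds (2 * κ * b)) := by
    have h1 := tendsto_const_rpow hκ0 hκt (hu.const_sub 1)
    have h2 := tendsto_const_rpow hδ0 hδt hu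
    rw [sub_zero, ENNReal.rpow_one] at h1
    rw [ENNReal.rpow_zero] at h2
    have h3 := ENNReal.Tendsto.const_mul (a := 2) h1 (Or.inr (by simp))
    have h4 := ENNReal.Tendsto.const_mul (a := b) h2 (Or.inr hb.ne_top)
    rw [mul_one] at h4
    exact ENNReal.Tendsto.mul h3 (Or.inr hb.ne_top) h4 (Or.inr (by finiteness))
  rw [← hlim.liminf_eq]
  refine Filter.liminf_le_liminf (Filter.Eventually.of_forall fun p => ?_)
  have hp : (0 : ℝ) < evenAbove p := by
    have := two_le_evenAbove p; positivity
  have hp1 : (1 : ℝ) ≤ evenAbove p := by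
    have := two_le_evenAbove p; exact_mod_cast (by omega : 1 ≤ evenAbove p)
  refine mul_le_mul' (mul_le_mul_right ?_ _) ?_
  · rw [show 1 - 1 / (evenAbove p : ℝ) = ((evenAbove p : ℝ) - 1) / evenAbove p by
      field_simp]
    exact ENNReal.rpow_le_rpow hκ.le (div_nonneg (by linarith) hp.le)
  · refine le_trans (le_of_eq ?_) (ENNReal.rpow_le_rpow (hδ p) (by positivity))
    rw [ENNReal.mul_rpow_of_nonneg _ _ (by positivity), ← ENNReal.rpow_natCast,
      ← ENNReal.rpow_mul, mul_one_div_cancel hp.ne', ENNReal.rpow_one]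

/-- Fatou's lemma for the counting measure. -/
theorem sum_liminf_le {ι : Type*} (s : Finset ι) (a : ℕ → ι → ℝ≥0∞) :
    ∑ i ∈ s, Filter.liminf (fun p => a p i) Filter.atTop
      ≤ Filter.liminf (fun p => ∑ i ∈ s, a p i) Filter.atTop := by
  let _ : MeasurableSpace s := ⊤
  have h := lintegral_liminf_le (μ := (Measure.count : Measure s)) (f := fun p (i : s) => a p i)
    (u := Filter.atTop) fun p => measurable_from_top
  simp only [lintegral_count, tsum_fintype] at h
  rw [Finset.sum_coe_sort s (fun i => Filter.liminf (fun p => a p i) Filter.atTop)] at h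
  simpa only [fun p => Finset.sum_coe_sort s (fun i => a p i)] using h

theorem sum_le_concConst {M : ∀ k, Kernel (E k) (E (k + 1))} {f G : ∀ k, E k → ℝ}
    {H : ∀ k, E k → E (k + 1) → ℝ} {n k : ℕ} (hM : ∀ k < n, IsMarkovKernel (M k))
    (hG : ∀ k < n, Measurable (G k)) (hGpos : ∀ k < n, ∀ x, 0 < G k x)
    {μ : ∀ k, Measure (E (k + 1))} (hμ : ∀ k < n, ∀ y, μ k ≪ M k y)
    (hH : ∀ k < n, Measurable (Function.uncurry (H k))) (hHpos : ∀ k < n, ∀ x y, 0 < H k x y)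
    (hv : ∀ k ≤ n, Measurable (snell M f G n k)) (x : E k) :
    ∑ l ∈ Finset.Ico k n, 2 * (qBase G H k l * ratioBound (H l) (μ l) (snell M f G n (l + 1)))
      ≤ concConst M f G H n k x := by
  rw [Finset.sum_Ico_eq_sum_range]
  refine (Finset.sum_le_sum fun d hd => ?_).trans
    ((sum_liminf_le (Finset.range (n - k)) fun p d => 2 * qConst G H p k (k + d)
      * (qIter M G k (d + 1)
          (fun y : E (k + d + 1) => oscRatio (H (k + d)) y ^ (evenAbove p - 1)
            * ENNReal.ofReal (snell M f G n (k + d + 1) y ^ evenAbove p)) x)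
        ^ (1 / (evenAbove p : ℝ))).trans ?_)
  · have hd' : k + d < n := by have := Finset.mem_range.1 hd; omega
    exact le_liminf_lpConst_term d hd' hM hG hGpos (hμ _ hd') (hH _ hd') (hHpos _ hd')
      (hv _ hd') x
  · refine Filter.liminf_le_of_frequently_le' (Filter.Eventually.frequently ?_)
    filter_upwards [Filter.eventually_ge_atTop 1] with p hp
    exact le_iSup₂ (f := fun (p : ℕ) (_ : 1 ≤ p) => lpConst M f G H n p k x) p hp

end Iter

/-! ### Exponential moments of averages -/

/-- Jensen's inequality for a convex combination; no independence is involved. -/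
theorem lintegral_exp_sum_le {Ω ι : Type*} [MeasurableSpace Ω] {P : Measure Ω} (s : Finset ι)
    {p : ι → ℝ} (hp : ∀ i ∈ s, 0 ≤ p i) (hp1 : ∑ i ∈ s, p i = 1) {U : ι → Ω → ℝ}
    (hU : ∀ i ∈ s, Measurable (U i)) {C : ℝ≥0∞}
    (hC : ∀ i ∈ s, ∫⁻ ω, ENNReal.ofReal (Real.exp (U i ω)) ∂P ≤ C) :
    ∫⁻ ω, ENNReal.ofReal (Real.exp (∑ i ∈ s, p i * U i ω)) ∂P ≤ C := by
  calc ∫⁻ ω, ENNReal.ofReal (Real.exp (∑ i ∈ s, p i * U i ω)) ∂P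
      ≤ ∫⁻ ω, ∑ i ∈ s, ENNReal.ofReal (p i) * ENNReal.ofReal (Real.exp (U i ω)) ∂P := by
        refine lintegral_mono fun ω => ?_
        have h := convexOn_exp.map_sum_le hp hp1 (p := fun i => U i ω) fun i _ => mem_univ _
        simp only [smul_eq_mul] at h
        refine (ENNReal.ofReal_le_ofReal h).trans (le_of_eq ?_)
        rw [ENNReal.ofReal_sum_of_nonneg fun i hi => mul_nonneg (hp i hi) (Real.exp_pos _).le]
        exact Finset.sum_congr rfl fun i hi => ENNReal.ofReal_mul (hp i hi)
    _ = ∑ i ∈ s, ENNReal.ofReal (p i) * ∫⁻ ω, ENNReal.ofReal (Real.exp (U i ω)) ∂P := by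
        have hm : ∀ i ∈ s, Measurable fun ω => ENNReal.ofReal (Real.exp (U i ω)) :=
          fun i hi => (Real.measurable_exp.comp (hU i hi)).ennreal_ofReal
        rw [lintegral_finsetSum' _ fun i hi => ((hm i hi).const_mul _).aemeasurable]
        exact Finset.sum_congr rfl fun i hi => lintegral_const_mul _ (hm i hi)
    _ ≤ ∑ i ∈ s, ENNReal.ofReal (p i) * C :=
        Finset.sum_le_sum fun i hi => mul_le_mul_right (hC i hi) _
    _ = C := by
        rw [← Finset.sum_mul, ← ENNReal.ofReal_sum_of_nonneg hp, hp1, ENNReal.ofReal_one, one_mul]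

/-- Chernoff bound for a sum of sub-Gaussian variables of arbitrary dependence. -/
theorem measure_lt_le_of_sum_subgaussian {Ω ι : Type*} [MeasurableSpace Ω] {P : Measure Ω}
    {s : Finset ι} (hs : s.Nonempty) {R : ι → Ω → ℝ} (hR : ∀ i ∈ s, Measurable (R i))
    {β : ι → ℝ} (hβ : ∀ i ∈ s, 0 < β i) {r c ε : ℝ} (hr : 0 < r) (hc : 0 < c) (hε : 0 < ε)
    (hsum : ∑ i ∈ s, β i ≤ 5 / 8 * c)
    (hexp : ∀ i ∈ s, ∀ t : ℝ, 0 ≤ t → ∫⁻ ω, ENNReal.ofReal (Real.exp (t * (r * R i ω / β i))) ∂P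
      ≤ ENNReal.ofReal (2 * Real.exp (t ^ 2 / 2)))
    {X : Ω → ℝ} (hX : ∀ᵐ ω ∂P, X ω ≤ ∑ i ∈ s, R i ω) :
    P {ω | c / r + ε < X ω} ≤ ENNReal.ofReal (Real.exp (-(r ^ 2 * ε ^ 2) / c ^ 2)) := by
  set B := ∑ i ∈ s, β i with hB
  have hBpos : 0 < B := Finset.sum_pos hβ hs
  -- After division by `B` the event says that a convex combination of normalised errors exceeds
  -- `τ`; the Chernoff exponent `t ^ 2 / 2 - t τ` is smallest at `t = τ`.
  set τ := (c + r * ε) / B with hτ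
  have hτ0 : 0 < τ := by positivity
  have hmean := lintegral_exp_sum_le (P := P) s (p := fun i => β i / B)
    (fun i hi => div_nonneg (hβ i hi).le hBpos.le)
    (by rw [← Finset.sum_div, ← hB, div_self hBpos.ne'])
    (U := fun i ω => τ * (r * R i ω / β i))
    (fun i hi => (((hR i hi).const_mul _).div_const _).const_mul _)
    (fun i hi => hexp i hi τ hτ0.le)
  have hrew : ∀ ω, ∑ i ∈ s, β i / B * (τ * (r * R i ω / β i)) = τ * (r / B * ∑ i ∈ s, R i ω) := by
    intro ω
    rw [Finset.mul_sum, Finset.mul_sum]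
    refine Finset.sum_congr rfl fun i hi => ?_
    have := (hβ i hi).ne'
    field_simp
  simp_rw [hrew] at hmean
  have hsub : P {ω | c / r + ε < X ω} ≤ P {ω | ENNReal.ofReal (Real.exp (τ * τ)) ≤
      ENNReal.ofReal (Real.exp (τ * (r / B * ∑ i ∈ s, R i ω)))} := by
    refine measure_mono_ae (hX.mono fun ω hω hlt => ?_)
    have hlt' : c / r + ε < X ω := hlt
    refine ENNReal.ofReal_le_ofReal (Real.exp_le_exp.2 (mul_le_mul_of_nonneg_left ?_ hτ0.le))
    have e : τ = r / B * (c / r + ε) := by rw [hτ]; field_simp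
    rw [e]
    exact mul_le_mul_of_nonneg_left (hlt'.le.trans hω) (by positivity)
  have hmeas : Measurable fun ω =>
      ENNReal.ofReal (Real.exp (τ * (r / B * ∑ i ∈ s, R i ω))) :=
    (Real.measurable_exp.comp
      (((Finset.measurable_sum _ fun i hi => hR i hi).const_mul _).const_mul _)).ennreal_ofReal
  have hmk := (mul_meas_ge_le_lintegral (μ := P) hmeas (ENNReal.ofReal (Real.exp (τ * τ)))).trans
    hmean
  refine hsub.trans ?_
  have hpos : 0 < Real.exp (τ * τ) := Real.exp_pos _
  rw [mul_comm, ← ENNReal.le_div_iff_mul_le (Or.inl (by simpa using hpos)) (Or.inl (by simp)),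
    ← ENNReal.ofReal_div_of_pos hpos] at hmk
  refine hmk.trans (ENNReal.ofReal_le_ofReal ?_)
  set w := r * ε / c with hw
  have hw0 : 0 < w := by positivity
  have hτw : 8 / 5 * (1 + w) ≤ τ := by
    rw [hτ, le_div_iff₀ hBpos]
    have e : c + r * ε = c * (1 + w) := by rw [hw]; field_simp
    rw [e]
    nlinarith [mul_le_mul_of_nonneg_right hsum (by positivity : 0 ≤ 8 / 5 * (1 + w))]
  -- Here `(8/5) ^ 2 / 2 = 32/25 ≥ 1`; the surplus 1 pays for the prefactor `2 ≤ e`.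
  have hsq : 1 + w ^ 2 ≤ τ ^ 2 / 2 := by
    nlinarith [mul_self_le_mul_self (by positivity) hτw]
  have h2 : (2 : ℝ) ≤ Real.exp 1 := by linarith [Real.add_one_le_exp (1 : ℝ)]
  calc 2 * Real.exp (τ ^ 2 / 2) / Real.exp (τ * τ)
      ≤ Real.exp 1 * Real.exp (τ ^ 2 / 2) / Real.exp (τ * τ) := by gcongr
    _ = Real.exp (1 - τ ^ 2 / 2) := by
        rw [← Real.exp_add, ← Real.exp_sub]
        congr 1
        ring
    _ ≤ Real.exp (-(r ^ 2 * ε ^ 2) / c ^ 2) := by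
        refine Real.exp_le_exp.2 ?_
        have e : -(r ^ 2 * ε ^ 2) / c ^ 2 = -w ^ 2 := by rw [hw]; field_simp
        rw [e]
        linarith

/-! ### The joint law of two consecutive configurations -/

section Law

variable {N : ℕ} {X Y : Type u} [MeasurableSpace X] [MeasurableSpace Y]

theorem measurable_particleStep_apply (M : Kernel X Y) {G : X → ℝ} (hG : Measurable G) (s : ℝ)
    (i : Fin N) {A : Set Y} (hA : MeasurableSet A) :
    Measurable fun z : Fin N → X => particleStep M G s z i A := by
  have hMA : ∀ j, Measurable fun z : Fin N → X => M (z j) A := fun j =>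
    (M.measurable_coe hA).comp (measurable_pi_apply j)
  have hGz : ∀ j, Measurable fun z : Fin N → X => G (z j) := fun j =>
    hG.comp (measurable_pi_apply j)
  simp only [particleStep_eq, Measure.add_apply, Measure.smul_apply, Measure.finsetSum_apply,
    smul_eq_mul]
  refine (((hGz i).const_mul s).ennreal_ofReal.mul (hMA i)).add
    ((((hGz i).const_mul s).const_sub 1).ennreal_ofReal.mul
      (Finset.measurable_sum _ fun j _ => Measurable.mul ?_ (hMA j)))
  exact ((hGz j).div (Finset.measurable_sum _ fun l _ => hGz l)).ennreal_ofReal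

/-- The transition of the configuration of particles. -/
noncomputable def configKernel (M : Kernel X Y) [IsMarkovKernel M] {G : X → ℝ}
    (hGm : Measurable G) (hG : ∀ x, 0 < G x) {s : ℝ} (hs : ∀ x, s * G x ∈ Icc (0 : ℝ) 1) :
    Kernel (Fin N → X) (Fin N → Y) where
  toFun z := Measure.pi fun i => particleStep M G s z i
  measurable' := by
    have hp := isProbabilityMeasure_particleStep (N := N) M hG hs
    refine Measurable.measure_of_isPiSystem_of_isProbabilityMeasure generateFrom_pi.symm
      isPiSystem_pi ?_
    rintro _ ⟨A, hA, rfl⟩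
    simp only [Measure.pi_pi]
    exact Finset.measurable_prod _ fun i _ =>
      measurable_particleStep_apply M hGm s i (hA i (mem_univ i))

theorem configKernel_apply (M : Kernel X Y) [IsMarkovKernel M] {G : X → ℝ}
    (hGm : Measurable G) (hG : ∀ x, 0 < G x) {s : ℝ} (hs : ∀ x, s * G x ∈ Icc (0 : ℝ) 1)
    (z : Fin N → X) :
    configKernel M hGm hG hs z = Measure.pi fun i => particleStep M G s z i := rfl

instance isMarkovKernel_configKernel (M : Kernel X Y) [IsMarkovKernel M] {G : X → ℝ}
    (hGm : Measurable G) (hG : ∀ x, 0 < G x) {s : ℝ} (hs : ∀ x, s * G x ∈ Icc (0 : ℝ) 1) :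
    IsMarkovKernel (configKernel (N := N) M hGm hG hs) := by
  refine ⟨fun z => ?_⟩
  have hp := isProbabilityMeasure_particleStep (N := N) M hG hs
  rw [configKernel_apply]
  infer_instance

end Law

section Model

variable {N : ℕ} {E : ℕ → Type u} [∀ k, MeasurableSpace (E k)]
    {Ω : Type*} [MeasurableSpace Ω] {P : Measure Ω} {n : ℕ} {η₀ : Measure (E 0)}
    {M : ∀ k, Kernel (E k) (E (k + 1))} {G : ∀ k, E k → ℝ} {s : ℝ}
    {ξ : ∀ k, Ω → Fin N → E k}

/-- `step` only tests boxes of particle positions. Restricting `P` to `{ξ l ∈ A}` and applying the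
π-λ theorem to boxes extends it to all measurable sets. -/
theorem IsParticleModel.map_prodMk_eq [IsProbabilityMeasure P]
    (hξ : IsParticleModel P n η₀ M G s ξ) {l : ℕ}
    (hl : l < n) [IsMarkovKernel (M l)] (hGm : Measurable (G l)) (hG : ∀ x, 0 < G l x)
    (hs : ∀ x, s * G l x ∈ Icc (0 : ℝ) 1) :
    P.map (fun ω => (ξ l ω, ξ (l + 1) ω)) = P.map (ξ l) ⊗ₘ configKernel (M l) hGm hG hs := by
  have h0 := hξ.measurable l hl.le
  have h1 := hξ.measurable (l + 1) hl
  have hp := isProbabilityMeasure_particleStep (N := N) (M l) hG hs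
  have : IsProbabilityMeasure (P.map (ξ l)) := Measure.isProbabilityMeasure_map h0.aemeasurable
  have : IsProbabilityMeasure (P.map fun ω => (ξ l ω, ξ (l + 1) ω)) :=
    Measure.isProbabilityMeasure_map (h0.prodMk h1).aemeasurable
  refine Measure.ext_prod fun {A B} hA hB => ?_
  have hAm : MeasurableSet (ξ l ⁻¹' A) := h0 hA
  have hAs : MeasurableSet[⨆ j ≤ l, MeasurableSpace.comap (ξ j) inferInstance] (ξ l ⁻¹' A) :=
    (le_iSup₂ (f := fun j (_ : j ≤ l) => MeasurableSpace.comap (ξ j) inferInstance) l le_rfl) _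
      ⟨A, hA, rfl⟩
  have key : (P.restrict (ξ l ⁻¹' A)).map (ξ (l + 1))
      = ((P.restrict (ξ l ⁻¹' A)).map (ξ l)).bind (configKernel (M l) hGm hG hs) := by
    refine ext_of_generate_finite _ generateFrom_pi.symm isPiSystem_pi ?_ ?_
    · rintro _ ⟨C, hC, rfl⟩
      have hC' : ∀ i, MeasurableSet (C i) := fun i => hC i (mem_univ i)
      have hCm : MeasurableSet (univ.pi C) := MeasurableSet.univ_pi hC'
      rw [Measure.map_apply h1 hCm, Measure.restrict_apply (h1 hCm),
        Measure.bind_apply hCm (Kernel.aemeasurable _),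
        lintegral_map (Kernel.measurable_coe _ hCm) h0, inter_comm]
      have := hξ.step l hl _ hAs C hC'
      simp only [configKernel_apply, Measure.pi_pi]
      rw [← this]
      congr 2
      ext ω
      simp
    · rw [Measure.map_apply h1 MeasurableSet.univ,
        Measure.bind_apply MeasurableSet.univ (Kernel.aemeasurable _)]
      simp [Measure.map_apply h0 MeasurableSet.univ]
  rw [Measure.map_apply (h0.prodMk h1) (hA.prod hB), Measure.compProd_apply_prod hA hB,
    setLIntegral_map hA (Kernel.measurable_coe _ hB) h0]
  have := congrArg (fun μ => μ B) key
  rw [Measure.map_apply h1 hB, Measure.restrict_apply (h1 hB),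
    Measure.bind_apply hB (Kernel.aemeasurable _),
    lintegral_map (Kernel.measurable_coe _ hB) h0, inter_comm] at this
  exact this

theorem IsParticleModel.lintegral_le [IsProbabilityMeasure P]
    (hξ : IsParticleModel P n η₀ M G s ξ) {l : ℕ}
    (hl : l < n) [IsMarkovKernel (M l)] (hGm : Measurable (G l)) (hG : ∀ x, 0 < G l x)
    (hs : ∀ x, s * G l x ∈ Icc (0 : ℝ) 1)
    {F : (Fin N → E l) × (Fin N → E (l + 1)) → ℝ≥0∞} (hF : Measurable F) {C : ℝ≥0∞}
    (hC : ∀ z, ∫⁻ y, F (z, y) ∂(Measure.pi fun i => particleStep (M l) (G l) s z i) ≤ C) :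
    ∫⁻ ω, F (ξ l ω, ξ (l + 1) ω) ∂P ≤ C := by
  have h0 := hξ.measurable l hl.le
  have h1 := hξ.measurable (l + 1) hl
  have : IsProbabilityMeasure (P.map (ξ l)) := Measure.isProbabilityMeasure_map h0.aemeasurable
  rw [← lintegral_map (f := F) hF (h0.prodMk h1), hξ.map_prodMk_eq hl hGm hG hs,
    Measure.lintegral_compProd hF]
  calc _ ≤ ∫⁻ _, C ∂(P.map (ξ l)) := lintegral_mono fun z => hC z
    _ = C := by simp

end Model

/-! ### Propagation of the local errors -/

theorem empMean_nonneg {N : ℕ} {X : Type u} {z : Fin N → X} {φ : X → ℝ} (h : ∀ x, 0 ≤ φ x) :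
    0 ≤ empMean z φ :=
  div_nonneg (Finset.sum_nonneg fun _ _ => h _) (Nat.cast_nonneg _)

theorem empMean_mono {N : ℕ} {X : Type u} {z : Fin N → X} {φ ψ : X → ℝ}
    (h : ∀ i, φ (z i) ≤ ψ (z i)) : empMean z φ ≤ empMean z ψ :=
  div_le_div_of_nonneg_right (Finset.sum_le_sum fun i _ => h i) (Nat.cast_nonneg _)

theorem empMean_add {N : ℕ} {X : Type u} (z : Fin N → X) (φ ψ : X → ℝ) :
    empMean z (fun x => φ x + ψ x) = empMean z φ + empMean z ψ := by
  simp [empMean, Finset.sum_add_distrib, add_div]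

theorem empMean_const_mul {N : ℕ} {X : Type u} (z : Fin N → X) (r : ℝ) (φ : X → ℝ) :
    empMean z (fun x => r * φ x) = r * empMean z φ := by
  simp [empMean, ← Finset.mul_sum, mul_div_assoc]

/-- Summing the numerators over the starting particles reproduces the denominator, so `H`
disappears. This avoids a product of oscillation constants along the path. -/
theorem empMean_qDensity {N : ℕ} {X Y : Type u} {G : X → ℝ} {H : X → Y → ℝ} (hN : 0 < N)
    (hG : ∀ x, 0 < G x) (hHpos : ∀ x y, 0 < H x y) (z : Fin N → X) (z' : Fin N → Y)
    (φ : Y → ℝ) :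
    empMean z (fun x => empMean z' fun y => qDensity G H z x y * φ y)
      = empMean z G * empMean z' φ := by
  have hne : (Finset.univ : Finset (Fin N)).Nonempty := ⟨⟨0, hN⟩, Finset.mem_univ _⟩
  have hN' : (N : ℝ) ≠ 0 := by positivity
  have hq : ∀ y, ∑ i, qDensity G H z (z i) y * φ y = (∑ i, G (z i)) * φ y := fun y => by
    have hT : ∑ l, G (z l) * H (z l) y ≠ 0 :=
      (Finset.sum_pos (fun j _ => mul_pos (hG (z j)) (hHpos _ _)) hne).ne'
    rw [← Finset.sum_mul]
    congr 1
    unfold qDensity empMean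
    rw [← Finset.sum_div, ← Finset.sum_mul]
    field_simp
  unfold empMean
  rw [← Finset.sum_div, Finset.sum_comm]
  simp_rw [hq]
  rw [← Finset.mul_sum]
  field_simp

theorem ofReal_empMean_le_supNorm {N : ℕ} {X : Type u} (hN : 0 < N) (z : Fin N → X) (G : X → ℝ) :
    ENNReal.ofReal (empMean z G) ≤ supNorm fun x => ENNReal.ofReal (G x) := by
  have hN' : (0 : ℝ) < N := by exact_mod_cast hN
  by_cases h : supNorm (fun x => ENNReal.ofReal (G x)) = ∞
  · simp [h]
  rw [ENNReal.ofReal_le_iff_le_toReal h, empMean, div_le_iff₀ hN']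
  refine (Finset.sum_le_card_nsmul _ _ _ fun i _ =>
    (ENNReal.ofReal_le_iff_le_toReal h).1 (le_iSup (fun x => ENNReal.ofReal (G x)) (z i))).trans ?_
  simp [mul_comm]

theorem ofReal_qDensity_le {N : ℕ} {X Y : Type u} {G : X → ℝ} {H : X → Y → ℝ} (hN : 0 < N)
    (hG : ∀ x, 0 < G x) (hHpos : ∀ x y, 0 < H x y) (z : Fin N → X) (x : X) (y : Y) :
    ENNReal.ofReal (qDensity G H z x y)
      ≤ supNorm (fun x => ENNReal.ofReal (G x)) * supNorm (oscRatio H) := by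
  have h1 : ENNReal.ofReal (G x) ≤ supNorm fun x => ENNReal.ofReal (G x) :=
    le_iSup (fun x => ENNReal.ofReal (G x)) x
  have h2 : oscRatio H y ≤ supNorm (oscRatio H) := le_iSup (oscRatio H) y
  refine le_trans ?_ (mul_le_mul' h1 h2)
  by_cases h : oscRatio H y = ∞
  · rw [h, ENNReal.mul_top (by simpa using hG x)]
    exact le_top
  have := qDensity_mul_le (a := 1) (b := (oscRatio H y).toReal) hG hHpos hN (z := z) (x := x)
    (y := y) fun i => by
      rw [mul_one]
      exact (ENNReal.ofReal_le_iff_le_toReal h).1 (oscRatio_ge H x (z i) y)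
  rw [mul_one] at this
  refine (ENNReal.ofReal_le_ofReal this).trans (le_of_eq ?_)
  rw [ENNReal.ofReal_mul (hG x).le, ENNReal.ofReal_toReal h]

theorem one_le_supNorm_oscRatio {X Y : Type u} {H : X → Y → ℝ} (hHpos : ∀ x y, 0 < H x y)
    (x : X) (y : Y) : 1 ≤ supNorm (oscRatio H) := by
  refine le_trans ?_ ((oscRatio_ge H x x y).trans (le_iSup (oscRatio H) y))
  rw [div_self (hHpos x y).ne', ENNReal.ofReal_one]

theorem le_sum_prod_of_le_add_mul {n : ℕ} {e w g : ℕ → ℝ} (hg : ∀ j < n, 0 ≤ g j)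
    (hn : e n ≤ 0) (h : ∀ j < n, e j ≤ w j + g j * e (j + 1)) {j : ℕ} (hj : j ≤ n) :
    e j ≤ ∑ l ∈ Finset.Ico j n, (∏ i ∈ Finset.Ico j l, g i) * w l := by
  induction hj using Nat.decreasingInduction with
  | self => simpa using hn
  | of_succ j hj ih =>
    refine (h j hj).trans ?_
    rw [Finset.sum_eq_sum_Ico_succ_bot hj]
    simp only [Finset.Ico_self, Finset.prod_empty, one_mul]
    refine add_le_add le_rfl ((mul_le_mul_of_nonneg_left ih (hg j hj)).trans (le_of_eq ?_))
    rw [Finset.mul_sum]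
    refine Finset.sum_congr rfl fun l hl => ?_
    rw [Finset.prod_eq_prod_Ico_succ_bot (Finset.mem_Ico.1 hl).1, mul_assoc]

section Error

theorem snellHat_self {N : ℕ} {E : ℕ → Type u} (f G : ∀ k, E k → ℝ) (H : ∀ k, E k → E (k + 1) → ℝ) (n : ℕ)
    (z : ∀ k, Fin N → E k) : snellHat f G H n z n = f n := by
  rw [snellHat, Nat.sub_self, snellHatAux]

theorem snellHat_of_lt {N : ℕ} {E : ℕ → Type u} {f G : ∀ k, E k → ℝ}
    {H : ∀ k, E k → E (k + 1) → ℝ} {n k : ℕ} (hk : k < n) (z : ∀ k, Fin N → E k) (x : E k) :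
    snellHat f G H n z k x = max (f k x)
      (empMean (z (k + 1)) fun y =>
        qDensity (G k) (H k) (z k) x y * snellHat f G H n z (k + 1) y) := by
  rw [snellHat, show n - k = (n - (k + 1)) + 1 by omega]
  rfl

variable {N : ℕ} {E : ℕ → Type u} [∀ k, MeasurableSpace (E k)]
    {M : ∀ k, Kernel (E k) (E (k + 1))} {f G : ∀ k, E k → ℝ} {H : ∀ k, E k → E (k + 1) → ℝ}
    {n : ℕ}

theorem snell_self (M : ∀ k, Kernel (E k) (E (k + 1))) (f G : ∀ k, E k → ℝ) (n : ℕ) :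
    snell M f G n n = f n := by
  rw [snell, Nat.sub_self, snellAux]

theorem snell_of_lt {k : ℕ} (hk : k < n) (x : E k) :
    snell M f G n k x = max (f k x) (G k x * ∫ y, snell M f G n (k + 1) y ∂(M k x)) := by
  rw [snell, show n - k = (n - (k + 1)) + 1 by omega]
  rfl

theorem measurable_snell (hf : ∀ k ≤ n, Measurable (f k)) (hG : ∀ k < n, Measurable (G k))
    (hM : ∀ k < n, IsMarkovKernel (M k)) {k : ℕ} (hk : k ≤ n) :
    Measurable (snell M f G n k) := by
  induction hk using Nat.decreasingInduction with
  | self => rw [snell_self]; exact hf n le_rfl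
  | of_succ k hk ih =>
    have := hM k hk
    rw [show snell M f G n k = _ from funext fun x => snell_of_lt hk x]
    exact (hf k hk.le).max ((hG k hk).mul
      (StronglyMeasurable.integral_kernel (κ := M k) ih.stronglyMeasurable).measurable)

theorem abs_snell_sub_snellHat_le (hGpos : ∀ k < n, ∀ x, 0 < G k x)
    (hHpos : ∀ k < n, ∀ x y, 0 < H k x y) {k : ℕ} (hk : k < n) (z : ∀ k, Fin N → E k) (x : E k) :
    |snell M f G n k x - snellHat f G H n z k x| ≤
      localError (M k) (G k) (H k) (snell M f G n (k + 1)) (z k) (z (k + 1)) x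
      + empMean (z (k + 1)) fun y => qDensity (G k) (H k) (z k) x y *
          |snell M f G n (k + 1) y - snellHat f G H n z (k + 1) y| := by
  rw [snell_of_lt hk, snellHat_of_lt hk, max_comm (f k x), max_comm (f k x)]
  refine (abs_max_sub_max_le_abs _ _ _).trans ?_
  set q := qDensity (G k) (H k) (z k) x with hq
  set v := snell M f G n (k + 1)
  set v' := snellHat f G H n z (k + 1)
  set z' := z (k + 1)
  have h1 : |empMean z' (fun y => q y * v y) - empMean z' fun y => q y * v' y|
      ≤ empMean z' fun y => q y * |v y - v' y| := by
    unfold empMean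
    rw [← sub_div, ← Finset.sum_sub_distrib, abs_div, Nat.abs_cast]
    refine div_le_div_of_nonneg_right ((Finset.abs_sum_le_sum_abs _ _).trans
      (Finset.sum_le_sum fun i _ => ?_)) (Nat.cast_nonneg _)
    rw [← mul_sub, abs_mul, abs_of_nonneg (qDensity_nonneg (hGpos k hk) (hHpos k hk) _ _ _)]
  refine (abs_sub_le _ (empMean z' fun y => q y * v y) _).trans (add_le_add ?_ h1)
  rw [localError, abs_sub_comm]

/-- The factor by which the mean local error at time `l` enters the error at time `k`. -/
noncomputable def propFactor (G : ∀ k, E k → ℝ) (H : ∀ k, E k → E (k + 1) → ℝ) (k l : ℕ) :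
    ℝ≥0∞ :=
  supNorm (oscRatio (H k)) * ∏ m ∈ Finset.Ico k l, supNorm fun x => ENNReal.ofReal (G m x)

/-- The mean of the local errors at time `l` over the configuration at this time. -/
noncomputable def meanError (M : ∀ k, Kernel (E k) (E (k + 1))) (f G : ∀ k, E k → ℝ)
    (H : ∀ k, E k → E (k + 1) → ℝ) (n l : ℕ) (z : Fin N → E l) (z' : Fin N → E (l + 1)) : ℝ :=
  empMean z (localError (M l) (G l) (H l) (snell M f G n (l + 1)) z z')

theorem meanError_nonneg (l : ℕ) (z : Fin N → E l) (z' : Fin N → E (l + 1)) :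
    0 ≤ meanError M f G H n l z z' :=
  empMean_nonneg fun _ => abs_nonneg _

/-- The point `x` need not be a particle, so the first step uses a bound on the density; afterwards
the empirical means of the errors obey a scalar recursion with factors `η^N(G)`. The alternative in
`hz` is needed because `toReal` sends `∞` to 0. -/
theorem abs_snell_sub_snellHat_le_sum (hN : 0 < N) (hGpos : ∀ k < n, ∀ x, 0 < G k x)
    (hHpos : ∀ k < n, ∀ x y, 0 < H k x y) {k : ℕ} (hk : k < n) (z : ∀ k, Fin N → E k)
    (hz : ∀ l ∈ Finset.Ico (k + 1) n, propFactor G H k l ≠ ∞ ∨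
      meanError M f G H n l (z l) (z (l + 1)) = 0) (x : E k) :
    |snell M f G n k x - snellHat f G H n z k x| ≤
      localError (M k) (G k) (H k) (snell M f G n (k + 1)) (z k) (z (k + 1)) x
      + ∑ l ∈ Finset.Ico (k + 1) n,
          (propFactor G H k l).toReal * meanError M f G H n l (z l) (z (l + 1)) := by
  refine (abs_snell_sub_snellHat_le hGpos hHpos hk z x).trans (add_le_add le_rfl ?_)
  set e : ∀ j, E j → ℝ := fun j y => |snell M f G n j y - snellHat f G H n z j y| with he
  set q := qDensity (G k) (H k) (z k) x with hq
  have hq0 : ∀ y, 0 ≤ q y := fun y => qDensity_nonneg (hGpos k hk) (hHpos k hk) _ _ _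
  -- A maximum over the finite configuration stays finite even if `‖G_k‖ ‖h_{k+1}‖` is not.
  obtain ⟨i₀, -, hi₀⟩ := Finset.exists_max_image Finset.univ (fun i => q (z (k + 1) i))
    ⟨⟨0, hN⟩, Finset.mem_univ _⟩
  set ρ := q (z (k + 1) i₀) with hρ
  have h1 : empMean (z (k + 1)) (fun y => q y * e (k + 1) y)
      ≤ ρ * empMean (z (k + 1)) (e (k + 1)) := by
    rw [← empMean_const_mul]
    exact empMean_mono fun i =>
      mul_le_mul_of_nonneg_right (hi₀ i (Finset.mem_univ i)) (abs_nonneg _)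
  have hrec : ∀ j < n, empMean (z j) (e j) ≤ meanError M f G H n j (z j) (z (j + 1))
      + empMean (z j) (G j) * empMean (z (j + 1)) (e (j + 1)) := fun j hj => by
    rw [← empMean_qDensity hN (hGpos j hj) (hHpos j hj), meanError, ← empMean_add]
    exact empMean_mono fun i => abs_snell_sub_snellHat_le hGpos hHpos hj z (z j i)
  have h2 := le_sum_prod_of_le_add_mul (n := n) (e := fun j => empMean (z j) (e j))
    (w := fun j => meanError M f G H n j (z j) (z (j + 1))) (g := fun j => empMean (z j) (G j))
    (fun j hj => empMean_nonneg fun x => (hGpos j hj x).le)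
    (by simp [he, snell_self, snellHat_self, empMean]) hrec (Nat.succ_le_of_lt hk)
  refine h1.trans ((mul_le_mul_of_nonneg_left h2 (hq0 _)).trans ?_)
  rw [Finset.mul_sum]
  refine Finset.sum_le_sum fun l hl => ?_
  have hl' := Finset.mem_Ico.1 hl
  rcases hz l hl with hfin | h0
  · rw [← mul_assoc]
    refine mul_le_mul_of_nonneg_right ?_ (meanError_nonneg _ _ _)
    rw [← ENNReal.ofReal_le_iff_le_toReal hfin, ENNReal.ofReal_mul (hq0 _), propFactor,
      Finset.prod_eq_prod_Ico_succ_bot hl'.1, ← mul_assoc, mul_comm (supNorm _),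
      ENNReal.ofReal_prod_of_nonneg]
    · exact mul_le_mul' (ofReal_qDensity_le hN (hGpos k hk) (hHpos k hk) _ _ _)
        (Finset.prod_le_prod' fun m _ => ofReal_empMean_le_supNorm hN _ _)
    · intro m hm
      have := (Finset.mem_Ico.1 hm).2
      exact empMean_nonneg fun x => (hGpos m (by omega) x).le
  · simp [h0]

end Error

/-! ### Exponential moments of the local errors along the particle model -/

section Moments

variable {N : ℕ} {E : ℕ → Type u} [∀ k, MeasurableSpace (E k)]
    {Ω : Type*} [MeasurableSpace Ω] {P : Measure Ω}
    {n : ℕ} {η₀ : Measure (E 0)}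
    {M : ∀ k, Kernel (E k) (E (k + 1))} {G : ∀ k, E k → ℝ} {s : ℝ}
    {ξ : ∀ k, Ω → Fin N → E k} {l : ℕ} {H : E l → E (l + 1) → ℝ} {μ : Measure (E (l + 1))}
    {v : E (l + 1) → ℝ}

/-- Only the finitely many ratios `H x / H (z i)` matter, so their null sets can be united; a
separate essential supremum for each pair of points suffices. -/
theorem ae_abs_qDensity_mul_le (hN : 0 < N) (hG : ∀ x, 0 < G l x) (hHpos : ∀ x y, 0 < H x y)
    (hfin : ratioBound H μ v ≠ ∞)
    (hfin' : supNorm (fun x => ENNReal.ofReal (G l x)) * ratioBound H μ v ≠ ∞)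
    (z : Fin N → E l) (x : E l) :
    ∀ᵐ y ∂μ, |qDensity (G l) H z x y * v y|
      ≤ (supNorm (fun x => ENNReal.ofReal (G l x)) * ratioBound H μ v).toReal := by
  have h := ae_all_iff.2 fun i => ae_le_ratioBound H μ v x (z i)
  filter_upwards [h] with y hy
  rw [abs_mul, abs_of_nonneg (qDensity_nonneg hG hHpos z x y)]
  refine (qDensity_mul_le (b := (ratioBound H μ v).toReal) hG hHpos hN fun i =>
    (ENNReal.ofReal_le_iff_le_toReal hfin).1 (hy i)).trans ?_
  rw [← ENNReal.ofReal_le_iff_le_toReal hfin', ENNReal.ofReal_mul (hG x).le,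
    ENNReal.ofReal_toReal hfin]
  exact mul_le_mul_left (le_iSup (fun x => ENNReal.ofReal (G l x)) x) _

theorem measurable_localError_comp (hξ : IsParticleModel P n η₀ M G s ξ) (hl : l < n)
    [IsMarkovKernel (M l)]
    (hGm : Measurable (G l)) (hH : Measurable (Function.uncurry H)) (hv : Measurable v)
    {a : (Fin N → E l) → E l} (ha : Measurable a) :
    Measurable fun ω => localError (M l) (G l) H v (ξ l ω) (ξ (l + 1) ω) (a (ξ l ω)) :=
  have h0 := hξ.measurable l hl.le
  measurable_localError (M l) hGm hH hv h0 (hξ.measurable (l + 1) hl) (ha.comp h0)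

/-- Sub-Gaussian bound for a multiple of the local error at a point of the configuration. -/
theorem IsParticleModel.lintegral_exp_localError_le [IsProbabilityMeasure P]
    (hξ : IsParticleModel P n η₀ M G s ξ)
    (hl : l < n) [IsMarkovKernel (M l)]
    (hN : 0 < N) (hGm : Measurable (G l)) (hG : ∀ x, 0 < G l x)
    (hs : ∀ x, s * G l x ∈ Icc (0 : ℝ) 1)
    (hH : Measurable (Function.uncurry H)) (hHpos : ∀ x y, 0 < H x y)
    (hMH : ∀ x, M l x = μ.withDensity fun y => ENNReal.ofReal (H x y)) (hv : Measurable v)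
    {b : ℝ} (hb0 : 0 ≤ b) (hb : ∀ (z : Fin N → E l) x, ∀ᵐ y ∂μ, |qDensity (G l) H z x y * v y| ≤ b)
    {a : (Fin N → E l) → E l} (ha : Measurable a) {D β : ℝ} (hD : 0 ≤ D) (hβ : 0 < β)
    (hDb : D * b ≤ β) {t : ℝ} (ht : 0 ≤ t) :
    ∫⁻ ω, ENNReal.ofReal (Real.exp (t * (√(N : ℝ) *
        (D * localError (M l) (G l) H v (ξ l ω) (ξ (l + 1) ω) (a (ξ l ω))) / β))) ∂P
      ≤ ENNReal.ofReal (2 * Real.exp (t ^ 2 / 2)) := by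
  refine hξ.lintegral_le hl hGm hG hs
    (F := fun p => ENNReal.ofReal (Real.exp (t * (√(N : ℝ) *
        (D * localError (M l) (G l) H v p.1 p.2 (a p.1)) / β)))) ?_ fun z => ?_
  · have : Measurable fun p : (Fin N → E l) × (Fin N → E (l + 1)) =>
        localError (M l) (G l) H v p.1 p.2 (a p.1) :=
      measurable_localError (M l) hGm hH hv measurable_fst measurable_snd (ha.comp measurable_fst)
    exact (Real.measurable_exp.comp
      ((((this.const_mul _).const_mul _).div_const _).const_mul _)).ennreal_ofReal
  · have h := PathSnell.lintegral_exp_localError_le (M := M l) hGm hG hs hH hHpos hMH hv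
      (a z) z hN (hb z (a z)) (t := t * D / β) (by positivity)
    have e : ∀ y : Fin N → E (l + 1),
        t * (√(N : ℝ) * (D * localError (M l) (G l) H v z y (a z)) / β)
          = t * D / β * (√(N : ℝ) * localError (M l) (G l) H v z y (a z)) := fun y => by
      field_simp
    simp_rw [e]
    refine h.trans (ENNReal.ofReal_le_ofReal ?_)
    have h1 : D * b / β ≤ 1 := (div_le_one hβ).2 hDb
    have h2 : (D * b / β) ^ 2 ≤ 1 := pow_le_one₀ (by positivity) h1
    have h3 : (t * D / β) ^ 2 * b ^ 2 / 2 = t ^ 2 / 2 * (D * b / β) ^ 2 := by ring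
    rw [h3]
    gcongr
    exact mul_le_of_le_one_right (by positivity) h2

theorem IsParticleModel.ae_localError_eq_zero [IsProbabilityMeasure P]
    (hξ : IsParticleModel P n η₀ M G s ξ)
    (hl : l < n) [IsMarkovKernel (M l)]
    (hN : 0 < N) (hGm : Measurable (G l)) (hG : ∀ x, 0 < G l x)
    (hs : ∀ x, s * G l x ∈ Icc (0 : ℝ) 1)
    (hH : Measurable (Function.uncurry H)) (hHpos : ∀ x y, 0 < H x y)
    (hMH : ∀ x, M l x = μ.withDensity fun y => ENNReal.ofReal (H x y)) (hv : Measurable v)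
    (hb : ∀ (z : Fin N → E l) x, ∀ᵐ y ∂μ, |qDensity (G l) H z x y * v y| ≤ 0)
    {a : (Fin N → E l) → E l} (ha : Measurable a) :
    ∀ᵐ ω ∂P, localError (M l) (G l) H v (ξ l ω) (ξ (l + 1) ω) (a (ξ l ω)) = 0 := by
  have hm : Measurable fun p : (Fin N → E l) × (Fin N → E (l + 1)) =>
      ENNReal.ofReal (localError (M l) (G l) H v p.1 p.2 (a p.1)) :=
    (measurable_localError (M l) hGm hH hv measurable_fst measurable_snd
      (ha.comp measurable_fst)).ennreal_ofReal
  have h := hξ.lintegral_le hl hGm hG hs hm (C := 0) fun z =>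
    (lintegral_localError_eq_zero (M := M l) hG hs hH hHpos hMH (a z) z hN
      ((hb z (a z)).mono fun y hy => abs_nonpos_iff.1 hy)).le
  have h2 := (lintegral_eq_zero_iff
    (measurable_localError_comp hξ hl hGm hH hv ha).ennreal_ofReal).1 (le_antisymm h bot_le)
  filter_upwards [h2] with ω hω
  exact le_antisymm (by simpa using hω) (abs_nonneg _)

end Moments

/-! ### Exponential concentration -/

theorem measure_snell_sub_snellHat_le {E : ℕ → Type u} [∀ k, MeasurableSpace (E k)]
    {Ω : Type*} [MeasurableSpace Ω] {P : Measure Ω} [IsProbabilityMeasure P]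
    {n N : ℕ} (hN : 0 < N) {η₀ : Measure (E 0)}
    {M : ∀ k, Kernel (E k) (E (k + 1))} (hM : ∀ k < n, IsMarkovKernel (M k))
    {f G : ∀ k, E k → ℝ} (hf : ∀ k ≤ n, Measurable (f k))
    (hG : ∀ k < n, Measurable (G k)) (hGpos : ∀ k < n, ∀ x, 0 < G k x)
    {μ : ∀ k, Measure (E (k + 1))} {H : ∀ k, E k → E (k + 1) → ℝ}
    (hH : ∀ k < n, Measurable (Function.uncurry (H k)))
    (hHpos : ∀ k < n, ∀ x y, 0 < H k x y)
    (hMH : ∀ k < n, ∀ x, M k x = (μ k).withDensity fun y => ENNReal.ofReal (H k x y))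
    {s : ℝ} (hs : ∀ k < n, ∀ x, s * G k x ∈ Icc (0 : ℝ) 1)
    {ξ : ∀ k, Ω → Fin N → E k} (hξ : IsParticleModel P n η₀ M G s ξ)
    {k : ℕ} (hk : k < n) {ε : ℝ} (hε : 0 < ε) (x : E k) {c : ℝ} (hc : 0 < c)
    (hconc : concConst M f G H n k x ≤ ENNReal.ofReal c) :
    P {ω | c / √(N : ℝ) + ε < |snell M f G n k x - snellHat f G H n (fun j => ξ j ω) k x|}
      ≤ ENNReal.ofReal (Real.exp (-((N : ℝ) * ε ^ 2) / c ^ 2)) := by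
  have hN' : (0 : ℝ) < N := by exact_mod_cast hN
  have hvm : ∀ j ≤ n, Measurable (snell M f G n j) := fun j hj => measurable_snell hf hG hM hj
  have hμ : ∀ k < n, ∀ y, μ k ≪ M k y := fun k hk y => by
    rw [hMH k hk]
    exact withDensity_absolutelyContinuous'
      ((hH k hk).comp measurable_prodMk_left).ennreal_ofReal.aemeasurable
      (ae_of_all _ fun z => by simpa using hHpos k hk y z)
  have hsum := (sum_le_concConst hM hG hGpos hμ hH hHpos hvm x).trans hconc
  set B : ℕ → ℝ≥0∞ := fun l => ratioBound (H l) (μ l) (snell M f G n (l + 1)) with hB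
  set g : ℕ → ℝ≥0∞ := fun l => supNorm fun x => ENNReal.ofReal (G l x) with hg
  set K : ℕ → ℝ≥0∞ := fun l => qBase G H k l * B l with hK
  have hne : ∀ l ≤ n, Nonempty (E l) := by
    obtain ⟨ω⟩ : Nonempty Ω := P.nonempty_of_neZero
    exact fun l _ => ⟨ξ l ω ⟨0, hN⟩⟩
  have hg0 : ∀ l < n, g l ≠ 0 := fun l hl => by
    obtain ⟨y⟩ := hne l hl.le
    exact ((ENNReal.ofReal_pos.2 (hGpos l hl y)).trans_le
      (le_iSup (fun x => ENNReal.ofReal (G l x)) y)).ne'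
  obtain ⟨y₁⟩ := hne (k + 1) hk
  have hh1 : 1 ≤ supNorm (oscRatio (H k)) := one_le_supNorm_oscRatio (hHpos k hk) x y₁
  have hD0 : ∀ l ∈ Finset.Ico k n, propFactor G H k l ≠ 0 := fun l hl => by
    refine mul_ne_zero (one_pos.trans_le hh1).ne' (Finset.prod_ne_zero_iff.2 fun m hm => hg0 m ?_)
    have := (Finset.mem_Ico.1 hl).2
    have := (Finset.mem_Ico.1 hm).2
    omega
  have hKD : ∀ l, K l = propFactor G H k l * (g l * B l) := fun l => by
    simp only [hK, qBase, propFactor, hg]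
    ring
  have hKt : ∀ l ∈ Finset.Ico k n, K l ≠ ∞ := fun l hl htop => by
    refine (hsum.trans_lt ENNReal.ofReal_lt_top).ne (ENNReal.sum_eq_top.2 ⟨l, hl, ?_⟩)
    rw [show qBase G H k l * ratioBound (H l) (μ l) (snell M f G n (l + 1)) = ∞ from htop]
    simp
  have hgB : ∀ l ∈ Finset.Ico k n, g l * B l ≠ ∞ := fun l hl htop =>
    hKt l hl (by rw [hKD, htop, ENNReal.mul_top (hD0 l hl)])
  have hBt : ∀ l ∈ Finset.Ico k n, B l ≠ ∞ := fun l hl htop =>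
    hgB l hl (by rw [htop, ENNReal.mul_top (hg0 l (Finset.mem_Ico.1 hl).2)])
  -- The factor 2 in `lpConst` yields `c / 2`.
  have hKsum : ∑ l ∈ Finset.Ico k n, (K l).toReal ≤ c / 2 := by
    have h1 : ENNReal.ofReal (2 * ∑ l ∈ Finset.Ico k n, (K l).toReal) ≤ ENNReal.ofReal c := by
      refine le_trans (le_of_eq ?_) hsum
      rw [ENNReal.ofReal_mul (by norm_num), ENNReal.ofReal_sum_of_nonneg
        (fun _ _ => ENNReal.toReal_nonneg), Finset.mul_sum]
      refine Finset.sum_congr rfl fun l hl => ?_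
      rw [ENNReal.ofReal_toReal (hKt l hl)]
      simp [hK, hB]
    have := (ENNReal.ofReal_le_ofReal_iff hc.le).1 h1
    linarith
  set b : ℕ → ℝ := fun l => (g l * B l).toReal with hb
  have hbae : ∀ l ∈ Finset.Ico k n, ∀ (z : Fin N → E l) y, ∀ᵐ y' ∂(μ l),
      |qDensity (G l) (H l) z y y' * snell M f G n (l + 1) y'| ≤ b l := fun l hl z y => by
    have hl' := (Finset.mem_Ico.1 hl).2
    exact ae_abs_qDensity_mul_le hN (hGpos l hl') (hHpos l hl') (hBt l hl) (hgB l hl) z y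
  set D : ℕ → ℝ := fun l => (propFactor G H k l).toReal with hD
  have hDb : ∀ l, D l * b l = (K l).toReal := fun l => by
    rw [hKD, ENNReal.toReal_mul]
  set W : Ω → ℝ := fun ω => localError (M k) (G k) (H k) (snell M f G n (k + 1))
    (ξ k ω) (ξ (k + 1) ω) x with hW
  set w : ℕ → Ω → ℝ := fun l ω => meanError M f G H n l (ξ l ω) (ξ (l + 1) ω) with hw
  -- At `l = k` the error is taken at `x` itself with weight 1; later errors are empirical means
  -- weighted by `D l`.
  set R : ℕ → Ω → ℝ := fun l ω => if l = k then W ω else D l * w l ω with hR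
  -- `K l` may vanish, so a total slack `c / 8` is shared among the `n - k` terms: `β` is positive
  -- and sums to at most `c / 2 + c / 8 = 5 c / 8`.
  set β : ℕ → ℝ := fun l => (K l).toReal + c / (8 * (n - k : ℕ)) with hβ
  have hnk : (0 : ℝ) < (n - k : ℕ) := by exact_mod_cast Nat.sub_pos_of_lt hk
  have hβK : ∀ l, (K l).toReal ≤ β l := fun l => le_add_of_nonneg_right (by positivity)
  have hβ0 : ∀ l, 0 < β l := fun l => add_pos_of_nonneg_of_pos ENNReal.toReal_nonneg (by positivity)
  have hβsum : ∑ l ∈ Finset.Ico k n, β l ≤ 5 / 8 * c := by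
    rw [hβ, Finset.sum_add_distrib, Finset.sum_const, Nat.card_Ico, nsmul_eq_mul]
    have : ((n - k : ℕ) : ℝ) * (c / (8 * (n - k : ℕ))) = c / 8 := by field_simp
    rw [this]
    linarith
  have hWm : Measurable W := by
    have := hM k hk
    exact measurable_localError (M k) (hG k hk) (hH k hk) (hvm _ hk) (hξ.measurable k hk.le)
      (hξ.measurable (k + 1) hk) measurable_const
  have hLm : ∀ l < n, ∀ i, Measurable fun ω => localError (M l) (G l) (H l)
      (snell M f G n (l + 1)) (ξ l ω) (ξ (l + 1) ω) (ξ l ω i) := fun l hl i => by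
    have := hM l hl
    exact measurable_localError (M l) (hG l hl) (hH l hl) (hvm _ hl) (hξ.measurable l hl.le)
      (hξ.measurable (l + 1) hl) ((measurable_pi_apply i).comp (hξ.measurable l hl.le))
  have hwm : ∀ l < n, Measurable (w l) := fun l hl =>
    (Finset.measurable_sum _ fun i _ => hLm l hl i).div_const _
  have hae : ∀ᵐ ω ∂P, ∀ l ∈ Finset.Ico (k + 1) n, propFactor G H k l ≠ ∞ ∨ w l ω = 0 := by
    refine (ae_ball_iff (Finset.countable_toSet _)).2 fun l hl => ?_
    have hl := Finset.mem_coe.1 hl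
    have hl1 := Finset.mem_Ico.1 hl
    have hl' : l ∈ Finset.Ico k n := Finset.mem_Ico.2 ⟨by omega, hl1.2⟩
    by_cases hfin : propFactor G H k l = ∞
    -- An infinite factor in the finite product `K l` forces the other factor to be 0, and the local
    -- errors then vanish almost surely.
    · have hb0 : b l = 0 := by
        by_contra h
        refine hKt l hl' ?_
        rw [hKD, hfin, ENNReal.top_mul fun h0 => h (by simp only [hb, h0, ENNReal.toReal_zero])]
      have := hM l hl1.2
      have h := ae_all_iff.2 fun i : Fin N => hξ.ae_localError_eq_zero hl1.2 hN (hG l hl1.2)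
        (hGpos l hl1.2) (hs l hl1.2) (hH l hl1.2) (hHpos l hl1.2) (hMH l hl1.2) (hvm _ hl1.2)
        (fun z y => hb0 ▸ hbae l hl' z y) (a := fun z => z i) (measurable_pi_apply i)
      filter_upwards [h] with ω hω
      right
      simp [hw, meanError, empMean, hω]
    · exact ae_of_all _ fun _ => Or.inl hfin
  have hX : ∀ᵐ ω ∂P, |snell M f G n k x - snellHat f G H n (fun j => ξ j ω) k x|
      ≤ ∑ l ∈ Finset.Ico k n, R l ω := by
    filter_upwards [hae] with ω hω
    refine (abs_snell_sub_snellHat_le_sum hN hGpos hHpos hk (fun j => ξ j ω) hω x).trans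
      (le_of_eq ?_)
    rw [Finset.sum_eq_sum_Ico_succ_bot hk]
    simp only [hR, if_true]
    congr 1
    refine Finset.sum_congr rfl fun l hl => ?_
    have := (Finset.mem_Ico.1 hl).1
    rw [if_neg (by omega)]
  have hexp : ∀ l ∈ Finset.Ico k n, ∀ t : ℝ, 0 ≤ t →
      ∫⁻ ω, ENNReal.ofReal (Real.exp (t * (√(N : ℝ) * R l ω / β l))) ∂P
        ≤ ENNReal.ofReal (2 * Real.exp (t ^ 2 / 2)) := by
    intro l hl t ht
    have hl' := (Finset.mem_Ico.1 hl).2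
    have := hM l hl'
    by_cases hlk : l = k
    · subst hlk
      have hbK : 1 * b l ≤ β l := by
        rw [one_mul]
        refine le_trans (ENNReal.toReal_mono (hKt l hl) ?_) (hβK l)
        rw [hKD, propFactor, Finset.Ico_self, Finset.prod_empty, mul_one]
        exact le_mul_of_one_le_left (by positivity) hh1
      have h := hξ.lintegral_exp_localError_le hl' hN (hG l hl') (hGpos l hl') (hs l hl')
        (hH l hl') (hHpos l hl') (hMH l hl') (hvm _ hl') ENNReal.toReal_nonneg (hbae l hl)
        (a := fun _ => x) measurable_const zero_le_one (hβ0 l) hbK ht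
      simpa only [hR, if_true, one_mul] using h
    · have h : ∀ i : Fin N, _ := fun i =>
        hξ.lintegral_exp_localError_le hl' hN (hG l hl') (hGpos l hl')
        (hs l hl') (hH l hl') (hHpos l hl') (hMH l hl') (hvm _ hl') ENNReal.toReal_nonneg
        (hbae l hl) (a := fun z => z i) (measurable_pi_apply i) (D := D l) ENNReal.toReal_nonneg (hβ0 l)
        ((hDb l).le.trans (hβK l)) ht
      -- Jensen again, now with weights `1 / N` over the particles at time `l`.
      have h2 := lintegral_exp_sum_le (P := P) (Finset.univ : Finset (Fin N))
        (p := fun _ => 1 / (N : ℝ)) (fun _ _ => by positivity)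
        (by simp [hN'.ne']) (fun i _ => ((((hLm l hl' i).const_mul _).const_mul _).div_const
          _).const_mul _) fun i _ => h i
      refine le_trans (le_of_eq ?_) h2
      refine lintegral_congr fun ω => ?_
      congr 2
      simp only [hR, if_neg hlk, hw, meanError, empMean]
      simp only [Finset.mul_sum, Finset.sum_div]
      refine Finset.sum_congr rfl fun i _ => ?_
      ring
  have hRm : ∀ l ∈ Finset.Ico k n, Measurable (R l) := by
    intro l hl
    by_cases hlk : l = k
    · simpa only [hR, hlk, if_true] using hWm
    · simpa only [hR, if_neg hlk] using (hwm l (Finset.mem_Ico.1 hl).2).const_mul _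
  have h := measure_lt_le_of_sum_subgaussian (P := P) (Finset.nonempty_Ico.2 hk) hRm
    (fun l _ => hβ0 l) (Real.sqrt_pos.2 hN') hc hε hβsum hexp hX
  rwa [Real.sq_sqrt hN'.le] at h

end PathSnell

theorem mainTheorem3 {E : ℕ → Type*} [∀ k, MeasurableSpace (E k)]
    {Ω : Type*} [MeasurableSpace Ω] (P : Measure Ω) [IsProbabilityMeasure P]
    (n N : ℕ) (hN : 1 ≤ N)
    (η₀ : Measure (E 0)) [IsProbabilityMeasure η₀]
    (M : ∀ k, Kernel (E k) (E (k + 1))) (hM : ∀ k < n, IsMarkovKernel (M k))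
    (f G : ∀ k, E k → ℝ)
    (hf : ∀ k ≤ n, Measurable (f k))
    (hG : ∀ k < n, Measurable (G k)) (hGpos : ∀ k < n, ∀ x, 0 < G k x)
    (lam : ∀ k, Measure (E (k + 1))) (H : ∀ k, E k → E (k + 1) → ℝ)
    (hH : ∀ k < n, Measurable (Function.uncurry (H k)))
    (hHpos : ∀ k < n, ∀ x y, 0 < H k x y)
    (hMH : ∀ k < n, ∀ x, M k x = (lam k).withDensity fun y => ENNReal.ofReal (H k x y))
    (hint : ∀ k < n, ∀ x, Integrable (PathSnell.snell M f G n (k + 1)) (M k x))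
    (s : ℝ) (hs : ∀ k < n, ∀ x, s * G k x ∈ Icc (0 : ℝ) 1)
    (ξ : ∀ k, Ω → Fin N → E k) (hξ : PathSnell.IsParticleModel P n η₀ M G s ξ)
    (k : ℕ) (hk : k ≤ n) (ε : ℝ) (hε : 0 < ε) :
    (∀ (x : E k) (c : ℝ), 0 < c →
      PathSnell.concConst M f G H n k x ≤ ENNReal.ofReal c →
      P {ω | c / √(N : ℝ) + ε < |PathSnell.snell M f G n k x
          - PathSnell.snellHat f G H n (fun j => ξ j ω) k x|}
        ≤ ENNReal.ofReal (Real.exp (-((N : ℝ) * ε ^ 2) / c ^ 2)))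
    ∧
    (∀ c : ℝ, 0 < c →
      (⨆ x : E k, PathSnell.concConst M f G H n k x) ≤ ENNReal.ofReal c →
      (⨆ x : E k, P {ω | c / √(N : ℝ) + ε < |PathSnell.snell M f G n k x
          - PathSnell.snellHat f G H n (fun j => ξ j ω) k x|})
        ≤ ENNReal.ofReal (Real.exp (-((N : ℝ) * ε ^ 2) / c ^ 2))) := by
  have key : ∀ (x : E k) (c : ℝ), 0 < c →
      PathSnell.concConst M f G H n k x ≤ ENNReal.ofReal c →
      P {ω | c / √(N : ℝ) + ε < |PathSnell.snell M f G n k x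
          - PathSnell.snellHat f G H n (fun j => ξ j ω) k x|}
        ≤ ENNReal.ofReal (Real.exp (-((N : ℝ) * ε ^ 2) / c ^ 2)) := by
    intro x c hc hconc
    rcases hk.lt_or_eq with hlt | rfl
    · exact PathSnell.measure_snell_sub_snellHat_le hN hM hf hG hGpos hH hHpos hMH hs hξ hlt hε x
        hc hconc
    · have h0 : ∀ ω : Ω, ¬ c / √(N : ℝ) + ε < |PathSnell.snell M f G k k x
          - PathSnell.snellHat f G H k (fun j => ξ j ω) k x| := fun ω => by
        rw [PathSnell.snell_self, PathSnell.snellHat_self, sub_self, abs_zero]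
        exact not_lt.2 (by positivity)
      simp [h0]
  exact ⟨key, fun c hc hconc => iSup_le fun x => key x c hc ((le_iSup _ x).trans hconc)⟩
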